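/- Let $a$ and $d$ be positive integers and let $\mathscr T_1,\dots,\mathscr T_d$ be locally finite, leafless, rooted directed trees, each of finite branching index (the depths of the vertices with at least two children are bounded); $\mathscr T_j$ has vertex set $V_j$, root $\mathsf{root}_j$ and depth function $\mathsf d$. Put $V=V_1\times\cdots\times V_d$ and, for $v\in V$, $\mathsf d_v=(\mathsf d_{v_1},\dots,\mathsf d_{v_d})\in\mathbb N^d$. Let $\mathsf{Chi}_j(v)$ be the set of $w\in V$ such that $w_j$ is a child of $v_j$ and $w_i=v_i$ for $i\neq j$. Let $S=(S_1,\dots,S_d)$ be the tuple of bounded operators on $\ell^2(V)$ given by $$S_j e_v=\sum_{w\in\mathsf{Chi}_j(v)}\lambda_j(w)e_w,\qquad \lambda_j(w)=\sqrt{\frac{\mathfrak c_a(|\mathsf d_v|)}{\operatorname{card}\mathsf{Chi}_j(v)}}\sqrt{\frac{\mathsf d_{v_j}+1}{|\mathsf d_v|+d}}\ \ (w\in\mathsf{Chi}_j(v)),\qquad \mathfrak c_a(t)=\frac{t+d}{t+a},$$ and let $E=\bigcap_j\ker S_j^*$. For $F\subseteq\{1,\dots,d\}$ let $\Phi_F$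 be the set of $u\in V$ such that $u_j\ne\mathsf{root}_j$ exactly for $j\in F$. For $u\in\Phi_F$ let $\mathsf{sib}_F(u)$ be the set of $w\in V$ such that $w_j$ and $u_j$ have the same parent for $j\in F$ and $w_j=u_j$ for $j\notin F$. Let $\Omega_F\subseteq\Phi_F$ contain exactly one element of each of the classes $\mathsf{sib}_F(u)$, and let $\mathcal L_{u,F}\subseteq E$ be the space of functions $f$ supported on $\mathsf{sib}_F(u)$ such that, for all $j\in F$ and $v\in\mathsf{sib}_F(u)$, $\sum_w f(w)\lambda_j(w)=0$, where $w$ runs over the vertices in $\mathsf{sib}_F(u)$ with $w_i=v_i$ for all $i\ne j$. Let $\mathscr H_{\mathfrak c_a}(\mathscr T)$ be the reproducing kernel Hilbert space of $E$-valued functions on the open unit ball $\mathbb B^d$ of $\mathbb C^d$ with kernel $$\kappa(z,w)=\sum_{F\subseteq\{1,\dots,d\}}\sum_{u\in\Omega_F}\Big(\sum_{\alpha\in\mathbb N^d}\frac{\mathsf d_u!}{(\mathsf d_u+\alpha)!}\prod_{i=0}^{|\alpha|-1}(|\mathsf d_u|+a+i)\,z^\alpha\overline w^{\alpha}\Big)P_{\mathcal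 L_{u,F}},$$ where $P_{\mathcal L_{u,F}}$ is the orthogonal projection of $E$ onto $\mathcal L_{u,F}$, and let $\mathscr H_a$ be the reproducing kernel Hilbert space of complex functions on $\mathbb B^d$ with kernel $(1-\langle z,w\rangle)^{-a}$. Then both kernels are positive semidefinite, and both spaces are invariant under multiplication by the coordinate functions, hence are Hilbert modules over $\mathbb C[z_1,\dots,z_d]$. Moreover, $\mathscr H_{\mathfrak c_a}(\mathscr T)$ and $\mathscr H_a$ are isomorphic as Hilbert modules (there is a unitary map $U:\mathscr H_{\mathfrak c_a}(\mathscr T)\to\mathscr H_a$ that intertwines the multiplications by $z_k$ for $k=1,\dots,d$) if and only if, for every $j=1,\dots,d$, the tree $\mathscr T_j$ is graph isomorphic to the rooted directed tree without branching vertices, that is, the tree with vertex set $\mathbb N$, root $0$ and edges $n\to n+1$. -/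

import Mathlib

noncomputable section

namespace TreeModule

universe u

/-! ### Rooted directed trees -/

/-- A locally finite, leafless, rooted directed tree with vertex set `V`: a connected directed graph
without circuits (in particular without loops) in which every vertex has at most one parent, with a
vertex `root` that has no parent, and in which every vertex has finitely many and at least one
child. (Such a tree is automatically countably infinite.) -/
structure RootedTree (V : Type u) where
  /-- `Adj u v`: there is a directed edge from the parent `u` to the child `v`. -/
  Adj : V → V → Prop
  root : V
  no_circuit : ∀ v, ¬ Relation.TransGen Adj v v
  connected : ∀ u v, Relation.EqvGen Adj u v
  parent_unique : ∀ u v w, Adj u w → Adj v w → u = v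
  root_no_parent : ∀ u, ¬ Adj u root
  locally_finite : ∀ u, {v | Adj u v}.Finite
  leafless : ∀ u, ∃ v, Adj u v

namespace RootedTree

variable {V : Type u} (T : RootedTree V)

/-- The set of children of a vertex. -/
def children (v : V) : Set V := {w | T.Adj v w}

open Classical in
/-- The parent of a vertex; by convention `par root = root`. -/
def par (v : V) : V := if h : ∃ u, T.Adj u v then h.choose else v

/-- The siblings of `v` (including `v` itself): the children of the parent of `v`. It is empty for
the root. -/
def sib (v : V) : Set V := {w | ∃ u, T.Adj u v ∧ T.Adj u w}

/-- The vertices that are reached from `v` by a directed path with `n` edges. -/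
def descendants (v : V) : ℕ → Set V
  | 0 => {v}
  | n + 1 => {w | ∃ u ∈ descendants v n, T.Adj u w}

/-- The depth of a vertex: the (unique) `n` such that `v` is an `n`-th descendant of the root. -/
def depth (v : V) : ℕ := sInf {n | v ∈ T.descendants T.root n}

/-- A branching vertex is a vertex with at least two children. -/
def IsBranching (v : V) : Prop := 2 ≤ (T.children v).ncard

/-- The branching index (one plus the supremum of the depths of the branching vertices, or zero if
there is no branching vertex) is finite. -/
def FiniteBranchingIndex : Prop := BddAbove (T.depth '' {v | T.IsBranching v})

lemma adj_par {v : V} (h : ∃ u, T.Adj u v) : T.Adj (T.par v) v := by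
  unfold par
  rw [dif_pos h]
  exact h.choose_spec

lemma exists_parent {v : V} (hv : v ≠ T.root) : ∃ u, T.Adj u v := by
  have key : ∀ a b, Relation.EqvGen T.Adj a b →
      ((Relation.ReflTransGen T.Adj T.root a) ↔ (Relation.ReflTransGen T.Adj T.root b)) := by
    intro a b h
    induction h with
    | rel a b h =>
      constructor
      · intro h1
        exact h1.tail h
      · intro h1
        rcases Relation.ReflTransGen.cases_tail h1 with h2 | ⟨c, hc, hcb⟩
        · subst h2
          exact absurd h (T.root_no_parent a)
        · rwa [T.parent_unique a c b h hcb]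
    | refl a => exact Iff.rfl
    | symm a b _ ih => exact ih.symm
    | trans a b c _ _ ih1 ih2 => exact ih1.trans ih2
  rcases Relation.ReflTransGen.cases_tail
    ((key _ _ (T.connected T.root v)).1 Relation.ReflTransGen.refl) with h | ⟨c, _, hc⟩
  · exact absurd h hv
  · exact ⟨c, hc⟩

lemma sib_finite (v : V) : (T.sib v).Finite := by
  by_cases h : ∃ u, T.Adj u v
  · obtain ⟨u, hu⟩ := h
    refine (T.locally_finite u).subset ?_
    rintro w ⟨p, hp, hw⟩
    rw [T.parent_unique u p v hu hp]
    exact hw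
  · refine Set.finite_empty.subset ?_
    rintro w ⟨p, hp, -⟩
    exact h ⟨p, hp⟩

end RootedTree

/-- The rooted directed tree without branching vertices: the vertices are the natural numbers, the
root is `0`, and there is an edge from `n` to `n + 1` for every `n`. -/
def rayTree : RootedTree ℕ where
  Adj m n := n = m + 1
  root := 0
  no_circuit v h := by
    have : ∀ w, Relation.TransGen (fun m n : ℕ => n = m + 1) v w → v < w := by
      intro w h
      induction h with
      | single h => omega
      | tail _ h ih => omega
    exact lt_irrefl _ (this v h)
  connected := by
    have h0 : ∀ n : ℕ, Relation.EqvGen (fun m n : ℕ => n = m + 1) 0 n := by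
      intro n
      induction n with
      | zero => exact .refl _
      | succ k ih => exact .trans _ _ _ ih (.rel _ _ rfl)
    exact fun u v => .trans _ _ _ (.symm _ _ (h0 u)) (h0 v)
  parent_unique u v w h1 h2 := by omega
  root_no_parent u h := by omega
  locally_finite u := by simp
  leafless u := ⟨u + 1, rfl⟩

lemma rayTree_not_isBranching (n : ℕ) : ¬ rayTree.IsBranching n := by
  have : rayTree.children n = {n + 1} := rfl
  simp [RootedTree.IsBranching, this]

/-- Two directed trees are graph isomorphic if there is a bijection between their vertex sets that
preserves (and reflects) directed edges. -/
def GraphIsomorphic {V : Type*} {W : Type*} (T : RootedTree V) (T' : RootedTree W) : Prop :=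
  ∃ e : V ≃ W, ∀ u v, T.Adj u v ↔ T'.Adj (e u) (e v)

/-! ### The directed Cartesian product and the multishift

The vertex set of the directed Cartesian product of `T 0, …, T (d - 1)` is `∀ j, V j`. -/

section Product

variable {d : ℕ} {V : Fin d → Type u} (T : ∀ j, RootedTree (V j))

/-- The depth of a vertex of the product, a multiindex. -/
def mdepth (v : ∀ j, V j) : Fin d → ℕ := fun j => (T j).depth (v j)

/-- The parent of `v` in the direction `j`. -/
def parAt (j : Fin d) (v : ∀ i, V i) : ∀ i, V i := Function.update v j ((T j).par (v j))

/-- The siblings of `v` in the direction `j`. -/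
def sibAt (j : Fin d) (v : ∀ i, V i) : Set (∀ i, V i) :=
  {w | w j ∈ (T j).sib (v j) ∧ ∀ i, i ≠ j → w i = v i}

/-- The vertices whose coordinates are different from the root exactly at the indices in `F`. -/
def Phi (F : Finset (Fin d)) : Set (∀ i, V i) := {v | ∀ j, v j ≠ (T j).root ↔ j ∈ F}

/-- `sib_F(u)`: the vertices obtained from `u` by replacing each coordinate `u j`, `j ∈ F`, by one
of its siblings. -/
def sibF (F : Finset (Fin d)) (u : ∀ i, V i) : Set (∀ i, V i) :=
  {w | (∀ j ∈ F, w j ∈ (T j).sib (u j)) ∧ ∀ j, j ∉ F → w j = u j}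

/-- An indexing set corresponding to `F`: it contains exactly one element of each of the classes
`sib_F(u)`, `u ∈ Φ_F`, namely the one picked by the axiom of choice. -/
def Omega (F : Finset (Fin d)) : Set (∀ i, V i) :=
  {u | u ∈ Phi T F ∧ ∀ h : (sibF T F u).Nonempty, h.some = u}

open Classical in
/-- `v_F`: the coordinates with index outside `F` are replaced by the roots. -/
def restrictTo (F : Finset (Fin d)) (v : ∀ i, V i) : ∀ i, V i :=
  fun j => if j ∈ F then v j else (T j).root

/-- The weights attached to a sequence `c` of positive numbers:
if `w` is a child of `v` in the direction `j`, then
`λ_j(w) = √(c(|d_v|) / card (Chi_j v)) * √((d_{v_j} + 1) / (|d_v| + d))`. -/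
def weight (c : ℕ → ℝ) (j : Fin d) (w : ∀ i, V i) : ℝ :=
  √(c (∑ i, mdepth T (parAt T j w) i) / ((T j).children (parAt T j w j)).ncard) *
    √((mdepth T (parAt T j w) j + 1) / ((∑ i, mdepth T (parAt T j w) i : ℕ) + d))

/-- The sequence `c_a(t) = (t + d) / (t + a)`. -/
def cSeq (a d : ℕ) (t : ℕ) : ℝ := ((t : ℝ) + d) / ((t : ℝ) + a)

/-- The complex Hilbert space of square summable functions on the vertex set of the product. -/
abbrev L2 (V : Fin d → Type u) : Type u := lp (fun _ : (∀ i, V i) => ℂ) 2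

open Classical in
/-- The action `(Λ_j f)(w) = λ_j(w) f(par_j(w))` (and `0` if `w j` is the root) of the `j`-th
component of the multishift with weights `λ_{c_a}` on functions on the vertex set. -/
def shiftFun (a : ℕ) (j : Fin d) (f : (∀ i, V i) → ℂ) : (∀ i, V i) → ℂ :=
  fun w => if w j = (T j).root then 0 else (weight T (cSeq a d) j w : ℂ) * f (parAt T j w)

lemma weight_sq_le (a : ℕ) (j : Fin d) (w : ∀ i, V i) :
    weight T (cSeq a d) j w ^ 2 ≤
      ((d : ℝ) + 1) * (((T j).children (parAt T j w j)).ncard : ℝ)⁻¹ := by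
  unfold weight
  set t : ℕ := ∑ i, mdepth T (parAt T j w) i with ht
  set b : ℕ := mdepth T (parAt T j w) j with hb
  set n : ℕ := ((T j).children (parAt T j w j)).ncard
  have hbt : b ≤ t := Finset.single_le_sum (f := fun i => mdepth T (parAt T j w) i)
    (fun i _ => Nat.zero_le _) (Finset.mem_univ j)
  have hd : (1 : ℝ) ≤ d := by
    have : 0 < d := j.pos
    exact_mod_cast this
  have hc0 : 0 ≤ cSeq a d t := by unfold cSeq; positivity
  have hc : cSeq a d t ≤ (d : ℝ) + 1 := by
    unfold cSeq
    rcases Nat.eq_zero_or_pos (t + a) with h | h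
    · have h' : (t : ℝ) + a = 0 := by exact_mod_cast h
      rw [h']
      simp only [div_zero]
      positivity
    · have h1 : (1 : ℝ) ≤ (t : ℝ) + a := by exact_mod_cast h
      rw [div_le_iff₀ (by linarith)]
      have : (0 : ℝ) ≤ a := Nat.cast_nonneg a
      have : (0 : ℝ) ≤ t := Nat.cast_nonneg t
      nlinarith
  have hq : ((b : ℝ) + 1) / ((t : ℝ) + d) ≤ 1 := by
    have : (b : ℝ) ≤ t := by exact_mod_cast hbt
    rw [div_le_one (by positivity)]
    linarith
  have hq0 : 0 ≤ ((b : ℝ) + 1) / ((t : ℝ) + d) := by positivity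
  rw [mul_pow, Real.sq_sqrt (by positivity), Real.sq_sqrt hq0, div_eq_mul_inv]
  have hn : (0 : ℝ) ≤ (n : ℝ)⁻¹ := by positivity
  calc cSeq a d t * (n : ℝ)⁻¹ * (((b : ℝ) + 1) / ((t : ℝ) + d))
      ≤ cSeq a d t * (n : ℝ)⁻¹ * 1 := by gcongr
    _ ≤ ((d : ℝ) + 1) * (n : ℝ)⁻¹ := by rw [mul_one]; gcongr

lemma sum_shiftFun_le (a : ℕ) (j : Fin d) (f : L2 V) (s : Finset (∀ i, V i)) :
    ∑ w ∈ s, ‖shiftFun T a j f w‖ ^ (2 : ENNReal).toReal ≤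
      ((d : ℝ) + 1) * ‖f‖ ^ (2 : ENNReal).toReal := by
  classical
  have h2 : (2 : ENNReal).toReal = (2 : ℕ) := by simp
  rw [h2]
  simp only [Real.rpow_natCast]
  set s' := s.filter (fun w => w j ≠ (T j).root) with hs'
  have e1 : ∑ w ∈ s, ‖shiftFun T a j f w‖ ^ 2 = ∑ w ∈ s', ‖shiftFun T a j f w‖ ^ 2 := by
    rw [hs', Finset.sum_filter]
    refine Finset.sum_congr rfl fun w _ => ?_
    by_cases h : w j = (T j).root <;> simp [shiftFun, h]
  have e2 : ∀ w ∈ s', ‖shiftFun T a j f w‖ ^ 2 ≤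
      ((d : ℝ) + 1) * (((T j).children (parAt T j w j)).ncard : ℝ)⁻¹ * ‖f (parAt T j w)‖ ^ 2 := by
    intro w hw
    have hw' : w j ≠ (T j).root := (Finset.mem_filter.1 hw).2
    simp only [shiftFun, if_neg hw', norm_mul, mul_pow, Complex.norm_real, Real.norm_eq_abs, sq_abs]
    gcongr
    exact weight_sq_le T a j w
  have e3 : ∀ u, ((s'.filter (fun w => parAt T j w = u)).card : ℝ) ≤
      ((T j).children (u j)).ncard := by
    intro u
    have : (s'.filter (fun w => parAt T j w = u)).card ≤ ((T j).children (u j)).ncard := by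
      rw [← Set.ncard_coe_finset]
      refine Set.ncard_le_ncard_of_injOn (fun w => w j) ?_ ?_ ((T j).locally_finite (u j))
      · intro w hw
        simp only [Finset.coe_filter, Set.mem_ofPred_eq, hs', Finset.mem_filter] at hw
        obtain ⟨⟨_, hw1⟩, hw2⟩ := hw
        have h := (T j).adj_par ((T j).exists_parent hw1)
        have : u j = (T j).par (w j) := by rw [← hw2]; simp [parAt]
        rw [← this] at h
        exact h
      · intro w hw w' hw' hj
        simp only [Finset.coe_filter, Set.mem_ofPred_eq] at hw hw'
        have h := hw.2.trans hw'.2.symm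
        funext i
        by_cases hi : i = j
        · subst hi; exact hj
        · have := congrFun h i
          simpa [parAt, hi] using this
    exact_mod_cast this
  rw [e1]
  calc ∑ w ∈ s', ‖shiftFun T a j f w‖ ^ 2
      ≤ ∑ w ∈ s', ((d : ℝ) + 1) * (((T j).children (parAt T j w j)).ncard : ℝ)⁻¹ *
          ‖f (parAt T j w)‖ ^ 2 := Finset.sum_le_sum e2
    _ = ∑ u ∈ s'.image (parAt T j), ∑ w ∈ s' with parAt T j w = u,
          ((d : ℝ) + 1) * (((T j).children (parAt T j w j)).ncard : ℝ)⁻¹ *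
            ‖f (parAt T j w)‖ ^ 2 :=
        (Finset.sum_fiberwise_of_maps_to (fun w hw => Finset.mem_image_of_mem _ hw) _).symm
    _ = ∑ u ∈ s'.image (parAt T j), ((s'.filter (fun w => parAt T j w = u)).card : ℝ) *
          (((d : ℝ) + 1) * (((T j).children (u j)).ncard : ℝ)⁻¹ * ‖f u‖ ^ 2) := by
        refine Finset.sum_congr rfl fun u _ => ?_
        rw [← nsmul_eq_mul, ← Finset.sum_const]
        refine Finset.sum_congr rfl fun w hw => ?_
        rw [(Finset.mem_filter.1 hw).2]
    _ ≤ ∑ u ∈ s'.image (parAt T j), ((d : ℝ) + 1) * ‖f u‖ ^ 2 := by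
        refine Finset.sum_le_sum fun u _ => ?_
        have h1 := e3 u
        set n : ℝ := (((T j).children (u j)).ncard : ℝ) with hn
        set m : ℝ := ((s'.filter (fun w => parAt T j w = u)).card : ℝ) with hm
        have hm0 : 0 ≤ m := by positivity
        have h2 : m * n⁻¹ ≤ 1 := by
          rw [← div_eq_mul_inv]
          exact div_le_one_of_le₀ h1 (by positivity)
        calc m * (((d : ℝ) + 1) * n⁻¹ * ‖f u‖ ^ 2)
            = (m * n⁻¹) * (((d : ℝ) + 1) * ‖f u‖ ^ 2) := by ring
          _ ≤ 1 * (((d : ℝ) + 1) * ‖f u‖ ^ 2) := by gcongr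
          _ = _ := one_mul _
    _ ≤ ((d : ℝ) + 1) * ‖f‖ ^ 2 := by
        rw [← Finset.mul_sum]
        have := lp.sum_rpow_le_norm_rpow (p := 2) (by simp) f (s'.image (parAt T j))
        rw [h2] at this
        simp only [Real.rpow_natCast] at this
        gcongr

/-- The `j`-th component `S_j` of the Drury-Arveson-type multishift, as a bounded operator. -/
def shift (a : ℕ) (j : Fin d) : L2 V →L[ℂ] L2 V :=
  LinearMap.mkContinuous
    { toFun := fun f => ⟨shiftFun T a j f, memℓp_gen' (sum_shiftFun_le T a j f)⟩
      map_add' := fun f g => by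
        ext w
        change shiftFun T a j (f + g : L2 V) w = shiftFun T a j f w + shiftFun T a j g w
        by_cases h : w j = (T j).root <;> simp [shiftFun, h, mul_add]
      map_smul' := fun c f => by
        ext w
        change shiftFun T a j (c • f : L2 V) w = c * shiftFun T a j f w
        by_cases h : w j = (T j).root <;> simp [shiftFun, h, mul_left_comm] }
    (√((d : ℝ) + 1)) (by
      intro f
      refine lp.norm_le_of_forall_sum_le (p := 2) (by simp) (by positivity) fun s => ?_
      refine (sum_shiftFun_le T a j f s).trans (le_of_eq ?_)
      have h2 : (2 : ENNReal).toReal = (2 : ℕ) := by simp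
      rw [h2]
      simp only [Real.rpow_natCast]
      rw [mul_pow, Real.sq_sqrt (by positivity)])

/-- The joint kernel `E = ⋂ j, ker S_j^*` of the adjoint of the multishift. -/
def jointKernel (a : ℕ) : Submodule ℂ (L2 V) :=
  ⨅ j, LinearMap.ker (ContinuousLinearMap.adjoint (shift T a j)).toLinearMap

instance (a : ℕ) : CompleteSpace (jointKernel T a) := by
  refine IsClosed.completeSpace_coe (hs := ?_)
  simp only [jointKernel, Submodule.coe_iInf]
  exact isClosed_iInter fun j => ContinuousLinearMap.isClosed_ker _

lemma sibAt_finite (j : Fin d) (v : ∀ i, V i) : (sibAt T j v).Finite := by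
  refine Set.Finite.of_finite_image (f := fun w => w j) (((T j).sib_finite (v j)).subset ?_) ?_
  · rintro _ ⟨w, hw, rfl⟩
    exact hw.1
  · intro w hw w' hw' h
    funext i
    by_cases hi : i = j
    · subst hi; exact h
    · rw [hw.2 i hi, hw'.2 i hi]

open Classical in
/-- The solution space `L_{u,F}`, as a subspace of the joint kernel: the functions `f` supported on
`sib_F(u)` such that `∑ f(w) λ_j(w) = 0`, where `w` runs over `sib_j(v_G | u_j)`, for all `j ∈ F`,
`G = F \ {j}` and `v ∈ sib_F(u)`. Here `v_G | u_j` is `v_G` with its `j`-th coordinate replaced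
by `u_j`. -/
def solutionSpace (a : ℕ) (u : ∀ i, V i) (F : Finset (Fin d)) : Submodule ℂ (jointKernel T a) where
  carrier := {f | (∀ w, w ∉ sibF T F u → (f : L2 V) w = 0) ∧
    ∀ j ∈ F, ∀ v ∈ sibF T F u,
      ∑ w ∈ (sibAt_finite T j
          (Function.update (restrictTo T (F.erase j) v) j (u j))).toFinset,
        (f : L2 V) w * (weight T (cSeq a d) j w : ℂ) = 0}
  add_mem' := by
    rintro f g ⟨hf1, hf2⟩ ⟨hg1, hg2⟩
    refine ⟨fun w hw => by simp [hf1 w hw, hg1 w hw], fun j hj v hv => ?_⟩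
    simp only [Submodule.coe_add, lp.coeFn_add, Pi.add_apply, add_mul, Finset.sum_add_distrib,
      hf2 j hj v hv, hg2 j hj v hv, add_zero]
  zero_mem' := by simp
  smul_mem' := by
    rintro c f ⟨hf1, hf2⟩
    refine ⟨fun w hw => by simp [hf1 w hw], fun j hj v hv => ?_⟩
    simp only [Submodule.coe_smul, lp.coeFn_smul, Pi.smul_apply, smul_eq_mul, mul_assoc]
    rw [← Finset.mul_sum, hf2 j hj v hv, mul_zero]

instance (a : ℕ) (u : ∀ i, V i) (F : Finset (Fin d)) : CompleteSpace (solutionSpace T a u F) := by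
  have hc : ∀ w, Continuous fun f : jointKernel T a => (f : L2 V) w := fun w =>
    (lp.evalCLM ℂ (fun _ : (∀ i, V i) => ℂ) 2 w).continuous.comp continuous_subtype_val
  refine IsClosed.completeSpace_coe (hs := ?_)
  change IsClosed {f : jointKernel T a | _ ∧ _}
  simp only [Set.ofPred_and, Set.ofPred_forall]
  refine IsClosed.inter ?_ ?_
  · exact isClosed_iInter fun w => isClosed_iInter fun _ => isClosed_eq (hc w) continuous_const
  · exact isClosed_iInter fun j => isClosed_iInter fun _ => isClosed_iInter fun v =>
      isClosed_iInter fun _ => isClosed_eq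
        (continuous_finsetSum _ fun w _ => (hc w).mul continuous_const) continuous_const

/-! ### Reproducing kernels and Hilbert modules -/

/-- The open unit ball of `ℂ^d`, with the Euclidean norm. -/
abbrev UnitBall (d : ℕ) : Type := Metric.ball (0 : EuclideanSpace ℂ (Fin d)) 1

/-- The scalar series
`∑_α β! / (β + α)! * ∏_{i < |α|} (|β| + a + i) * z^α * conj(w)^α` attached to a multiindex `β`. -/
def scalarKernel (a : ℕ) (β : Fin d → ℕ) (z w : UnitBall d) : ℂ :=
  ∑' α : Fin d → ℕ,
    ((∏ i, ((β i).factorial : ℂ)) / ∏ i, ((β i + α i).factorial : ℂ)) *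
      (∏ i ∈ Finset.range (∑ j, α j), ((∑ j, β j : ℕ) + a + i : ℂ)) *
      ((∏ i, z.1 i ^ α i) * ∏ i, (starRingEnd ℂ) (w.1 i) ^ α i)

/-- The `B(E)`-valued reproducing kernel of `H_{c_a}(T)`. -/
def treeKernel (a : ℕ) :
    Matrix (UnitBall d) (UnitBall d) (jointKernel T a →L[ℂ] jointKernel T a) :=
  Matrix.of fun z w => ∑ F : Finset (Fin d), ∑ᶠ u ∈ Omega T F,
    scalarKernel a (mdepth T u) z w • (solutionSpace T a u F).starProjection

/-- The classical kernel `1 / (1 - ⟨z, w⟩)^a` on the unit ball of `ℂ^d`. -/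
def classicalKernel (d a : ℕ) : Matrix (UnitBall d) (UnitBall d) (ℂ →L[ℂ] ℂ) :=
  Matrix.of fun z w => (1 / (1 - ∑ i, z.1 i * (starRingEnd ℂ) (w.1 i)) ^ a) •
    ContinuousLinearMap.id ℂ ℂ

end Product

/-- The reproducing kernel Hilbert space `H_{c_a}(T)` (its kernel has to be positive). -/
abbrev TreeSpace {d : ℕ} {V : Fin d → Type u} (T : ∀ j, RootedTree (V j)) (a : ℕ)
    [Fact (treeKernel T a).PosSemidef] : Type u :=
  RKHS.OfKernel (treeKernel T a)

/-- The reproducing kernel Hilbert space `H_a` with kernel `1 / (1 - ⟨z, w⟩)^a`. -/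
abbrev ClassicalSpace (d a : ℕ) [Fact (classicalKernel d a).PosSemidef] : Type :=
  RKHS.OfKernel (classicalKernel d a)

section Modules

variable {d : ℕ}
variable {E₁ : Type*} [NormedAddCommGroup E₁] [InnerProductSpace ℂ E₁]
variable {E₂ : Type*} [NormedAddCommGroup E₂] [InnerProductSpace ℂ E₂]
variable {H₁ : Type*} [NormedAddCommGroup H₁] [InnerProductSpace ℂ H₁] [CompleteSpace H₁]
  [RKHS ℂ H₁ (UnitBall d) E₁]
variable {H₂ : Type*} [NormedAddCommGroup H₂] [InnerProductSpace ℂ H₂] [CompleteSpace H₂]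
  [RKHS ℂ H₂ (UnitBall d) E₂]

variable (H₁) in
/-- A Hilbert space of functions on the unit ball is a Hilbert module over `ℂ[z_1, …, z_d]`, with
polynomials acting by multiplication, if it is invariant under multiplication by each coordinate
function. (The multiplication operators are then automatically bounded, see `coordMul`.) -/
def IsHilbertModule : Prop :=
  ∀ (k : Fin d) (f : H₁), ∃ g : H₁, ∀ z : UnitBall d, g z = z.1 k • f z

/-- The operator `M_{z_k}` of multiplication by the `k`-th coordinate function. -/
def coordMul (h : IsHilbertModule H₁) (k : Fin d) : H₁ →L[ℂ] H₁ :=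
  ContinuousLinearMap.ofSeqClosedGraph
    (g := { toFun := fun f => (h k f).choose
            map_add' := fun f g => by
              refine RKHS.ext fun z => ?_
              rw [(h k _).choose_spec z, RKHS.coe_add, RKHS.coe_add, Pi.add_apply, Pi.add_apply,
                (h k f).choose_spec z, (h k g).choose_spec z, smul_add]
            map_smul' := fun c f => by
              refine RKHS.ext fun z => ?_
              rw [(h k _).choose_spec z, RingHom.id_apply, RKHS.coe_smul, RKHS.coe_smul,
                Pi.smul_apply, Pi.smul_apply, (h k f).choose_spec z]
              exact smul_comm _ _ _ }) (by
      intro s x y hx hy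
      refine RKHS.ext fun z => ?_
      have h1 := ((RKHS.continuous_eval (H := H₁) z).tendsto y).comp hy
      have h2 := (((RKHS.continuous_eval (H := H₁) z).tendsto x).comp hx).const_smul (z.1 k)
      refine tendsto_nhds_unique h1 ?_
      have e : ((h k x).choose : H₁) z = z.1 k • x z := (h k x).choose_spec z
      simp only [LinearMap.coe_mk, AddHom.coe_mk]
      rw [e]
      refine h2.congr fun n => ?_
      exact ((h k (s n)).choose_spec z).symm)

lemma coordMul_apply (h : IsHilbertModule H₁) (k : Fin d) (f : H₁) (z : UnitBall d) :
    coordMul h k f z = z.1 k • f z := (h k f).choose_spec z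

/-- Two Hilbert modules are isomorphic if there is a unitary map that intertwines the operators of
multiplication by the coordinate functions. -/
def HilbertModulesIsomorphic (h₁ : IsHilbertModule H₁) (h₂ : IsHilbertModule H₂) : Prop :=
  ∃ U : H₁ ≃ₗᵢ[ℂ] H₂, ∀ (k : Fin d) (f : H₁), U (coordMul h₁ k f) = coordMul h₂ k (U f)

end Modules

end TreeModule

end

/-! The invariant that separates the two modules is the joint kernel of the adjoints `M_{z_k}^*`.
Since `z_k g` vanishes at the origin, this space always contains the kernel functions `k_0 η`. In
`H_a` it consists of constants, so it is at most one-dimensional (`apply_eq_apply_origin`). On the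
tree side `κ(0,0)` is the sum of the projections onto the spaces `L_{u,F}`, so `‖P_L η‖ ≤ ‖k_0 η‖`
for each of them. A branching vertex `p` of `T j` yields a nonzero `f` in some `L_{u,{j}}` that
vanishes at the root (`exists_mem_solutionSpace_singleton`). With the basis vector `e` at the root
it gives two independent functions `k_0 e`, `k_0 f`, which rules out an isomorphism.

Conversely, without branching every `L_{u,F}` with `F` nonempty is zero, and `L_{root,∅}` is spanned
by `e`. What remains of the kernel is `scalarKernel a 0` times a rank one projection, and the
multivariate binomial series identifies the scalar factor with `(1 - ⟨z,w⟩)^{-a}`. Pairing with `e`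
then induces the unitary.

Positivity and the module structure hold because each scalar kernel is diagonal in the monomials
with nonnegative coefficients, and these coefficients do not decrease under `α ↦ α + e_k`. So `(1 -
z_k conj w_k) κ` is positive too, which makes `M_{z_k}` a contraction. Finite branching index leaves
only finitely many nonzero `L_{u,F}`. -/

noncomputable section

open scoped ComplexConjugate InnerProductSpace

/-! ### Multipliers and unitaries constructed from kernels -/

namespace RKHS

variable {X E : Type*} [NormedAddCommGroup E] [InnerProductSpace ℂ E] [CompleteSpace E]
variable (H : Type*) [NormedAddCommGroup H] [InnerProductSpace ℂ H] [CompleteSpace H]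
  [RKHS ℂ H X E]

/-- The linear map sending the formal combination `∑ c (x, v)` to `∑ c k_x v`. -/
def kerComb : (X × E →₀ ℂ) →ₗ[ℂ] H :=
  Finsupp.linearCombination ℂ fun xv => kerFun H xv.1 xv.2

lemma kerComb_single (x : X) (v : E) (c : ℂ) :
    kerComb H (Finsupp.single (x, v) c) = c • kerFun H x v := by
  simp [kerComb]

lemma denseRange_kerComb : DenseRange (kerComb (X := X) H) := by
  have h := kerFun_dense H
  have e : Set.range (kerComb (X := X) H) = (Submodule.span ℂ {kerFun H x v | (x) (v)} : Set H) := by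
    rw [← LinearMap.coe_range, kerComb, Finsupp.range_linearCombination]
    congr 2
    ext f
    simp
  rw [DenseRange, e, ← Submodule.dense_iff_topologicalClosure_eq_top] at *
  exact h

lemma inner_linearCombination {G : Type*} [NormedAddCommGroup G] [InnerProductSpace ℂ G]
    {A : Type*} (k : A → G) (f : A →₀ ℂ) :
    ⟪Finsupp.linearCombination ℂ k f, Finsupp.linearCombination ℂ k f⟫_ℂ =
      f.sum fun p z => f.sum fun q w => conj z * w * ⟪k p, k q⟫_ℂ := by
  rw [Finsupp.linearCombination_apply, Finsupp.sum_inner]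
  simp only [Finsupp.sum, inner_smul_left, inner_smul_right, inner_sum, mul_assoc]
  exact Finset.sum_congr rfl fun _ _ => Finset.sum_congr rfl fun _ _ => mul_left_comm _ _ _

variable {H} in
/-- If `(1 - φ(x) conj φ(y)) k(x, y)` is positive, then `φ` is a multiplier. -/
lemma exists_smul_of_posSemidef (φ : X → ℂ)
    (hφ : (Matrix.of fun x y => (1 - φ x * conj (φ y)) • kernel H x y).PosSemidef) (f : H) :
    ∃ g : H, ∀ x, g x = φ x • f x := by
  set T₀ : (X × E →₀ ℂ) →ₗ[ℂ] H :=
    Finsupp.linearCombination ℂ fun xv => conj (φ xv.1) • kerFun H xv.1 xv.2 with hT₀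
  -- The difference of the squared norms is the quadratic form of `(1 - φ conj φ) k`, so the
  -- positivity hypothesis says exactly that `k_x v ↦ conj φ(x) k_x v` is contractive. The adjoint
  -- of its extension is multiplication by `φ`.
  have hle : ∀ f, ‖T₀ f‖ ≤ 1 * ‖kerComb H f‖ := by
    intro f
    rw [one_mul, ← sq_le_sq₀ (norm_nonneg _) (norm_nonneg _), ← inner_self_eq_norm_sq (𝕜 := ℂ),
      ← inner_self_eq_norm_sq (𝕜 := ℂ), hT₀, kerComb, inner_linearCombination,
      inner_linearCombination, ← sub_nonneg, ← map_sub]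
    have h : _ ∧ _ := (posSemidef_tfae.out 0 1).mp hφ
    replace h := h.2 f
    refine h.trans_eq (congrArg _ ?_)
    simp only [Finsupp.sum, ← Finset.sum_sub_distrib]
    refine Finset.sum_congr rfl fun p _ => Finset.sum_congr rfl fun q _ => ?_
    simp only [Matrix.of_apply, FunLike.coe_smul, Pi.smul_apply, inner_smul_left,
      inner_smul_right, kernel_inner, map_sub, map_mul, map_one, RCLike.conj_conj]
    ring
  set S : H →L[ℂ] H := T₀.extendOfNorm (kerComb H)
  refine ⟨S.adjoint f, fun x => ext_inner_left ℂ fun v => ?_⟩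
  have hS : S (kerFun H x v) = conj (φ x) • kerFun H x v := by
    have := LinearMap.extendOfNorm_eq (denseRange_kerComb H) ⟨1, hle⟩ (Finsupp.single (x, v) 1)
    rw [kerComb_single, one_smul] at this
    rw [this, hT₀]
    simp
  rw [← kerFun_inner, ContinuousLinearMap.adjoint_inner_right, hS, inner_smul_left, kerFun_inner,
    inner_smul_right, RCLike.conj_conj]

lemma posSemidef_iff {K : Matrix X X (E →L[ℂ] E)} :
    K.PosSemidef ↔ K.IsHermitian ∧ ∀ f : X →₀ E,
      0 ≤ RCLike.re (f.sum fun x v => f.sum fun y w => ⟪K y x v, w⟫_ℂ) :=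
  posSemidef_tfae.out 0 2

variable {E' : Type*} [NormedAddCommGroup E'] [InnerProductSpace ℂ E'] [CompleteSpace E']
variable (H' : Type*) [NormedAddCommGroup H'] [InnerProductSpace ℂ H'] [CompleteSpace H']
  [RKHS ℂ H' X E']

/-- A surjection between the value spaces that is compatible with the kernels induces a unitary
map. -/
lemma exists_linearIsometryEquiv (ℓ : E →L[ℂ] E') (hℓ : Function.Surjective ℓ)
    (hk : ∀ x y v w, ⟪kernel H x y v, w⟫_ℂ = ⟪kernel H' x y (ℓ v), ℓ w⟫_ℂ) :
    ∃ U : H ≃ₗᵢ[ℂ] H', ∀ f x v, ⟪ℓ v, U f x⟫_ℂ = ⟪v, f x⟫_ℂ := by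
  set e' : (X × E →₀ ℂ) →ₗ[ℂ] H' :=
    Finsupp.linearCombination ℂ fun xv => kerFun H' xv.1 (ℓ xv.2) with he'
  -- Surjectivity of `ℓ` ensures that every kernel function of `H'` is reached.
  have hd : DenseRange e' := by
    have h := kerFun_dense H'
    have e : Set.range e' = (Submodule.span ℂ {kerFun H' x v | (x) (v)} : Set H') := by
      rw [← LinearMap.coe_range, he', Finsupp.range_linearCombination]
      congr 2
      ext f
      constructor
      · rintro ⟨⟨x, v⟩, rfl⟩
        exact ⟨x, ℓ v, rfl⟩
      · rintro ⟨x, v, rfl⟩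
        obtain ⟨w, rfl⟩ := hℓ v
        exact ⟨(x, w), rfl⟩
    rw [DenseRange, e, ← Submodule.dense_iff_topologicalClosure_eq_top] at *
    exact h
  -- Equal Gram matrices: the identity on formal combinations descends to a unitary.
  have hn : ∀ f, ‖e' f‖ = ‖kerComb H f‖ := by
    intro f
    rw [← sq_eq_sq₀ (norm_nonneg _) (norm_nonneg _), ← inner_self_eq_norm_sq (𝕜 := ℂ),
      ← inner_self_eq_norm_sq (𝕜 := ℂ), he', kerComb, inner_linearCombination,
      inner_linearCombination]
    simp only [← kernel_inner, hk]
  refine ⟨(LinearEquiv.refl ℂ _).extendOfIsometry (kerComb H) e' (denseRange_kerComb H) hd hn,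
    fun f x v => ?_⟩
  set U := (LinearEquiv.refl ℂ _).extendOfIsometry (kerComb H) e' (denseRange_kerComb H) hd hn
  have hU : U (kerFun H x v) = kerFun H' x (ℓ v) := by
    have := LinearEquiv.extendOfIsometry_eq (LinearEquiv.refl ℂ _) (e₁ := kerComb H) (e₂ := e')
      (denseRange_kerComb H) hd hn (Finsupp.single (x, v) 1)
    rw [kerComb_single, one_smul] at this
    rw [this, he']
    simp
  rw [← kerFun_inner, ← hU, U.inner_map_map, kerFun_inner]

end RKHS

/-! ### Positivity of diagonal kernels -/

/-- `k` is a sum of rank one kernels `m_i(x) conj m_i(y)` with nonnegative coefficients. -/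
def IsDiagonalKernel {A X : Type*} (m : A → X → ℂ) (k : X → X → ℂ) : Prop :=
  ∃ c : A → ℝ, (∀ i, 0 ≤ c i) ∧ ∀ x y, HasSum (fun i => (c i : ℂ) * (m i x * conj (m i y))) (k x y)

namespace IsDiagonalKernel

variable {A X E : Type*} [NormedAddCommGroup E] [InnerProductSpace ℂ E] [CompleteSpace E]
variable {m : A → X → ℂ} {k : X → X → ℂ}

lemma conj_apply (h : IsDiagonalKernel m k) (x y : X) : conj (k x y) = k y x := by
  obtain ⟨c, -, h⟩ := h
  refine HasSum.unique ?_ (h y x)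
  have h' : HasSum (fun i => conj ((c i : ℂ) * (m i x * conj (m i y)))) (conj (k x y)) :=
    Complex.hasSum_conj'.2 (by simpa using h x y)
  simpa [mul_comm] using h'

/-- As `P = P* P`, the quadratic form at `f` equals `∑ c_i ‖∑_x conj (m_i x) P (f x)‖²`. -/
lemma posSemidef_smul (h : IsDiagonalKernel m k) (L : Submodule ℂ E)
    [L.HasOrthogonalProjection] :
    (Matrix.of fun x y => k x y • L.starProjection).PosSemidef := by
  refine RKHS.posSemidef_iff.2 ⟨?_, fun f => ?_⟩
  · ext x y : 2
    have : IsSelfAdjoint L.starProjection := isSelfAdjoint_starProjection L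
    rw [Matrix.conjTranspose_apply, Matrix.of_apply, Matrix.of_apply, star_smul, this.star_eq,
      RCLike.star_def, h.conj_apply]
  · have hconj := h.conj_apply
    obtain ⟨c, hc, hk⟩ := h
    have hP : ∀ v w, ⟪L.starProjection v, w⟫_ℂ =
        ⟪L.starProjection v, L.starProjection w⟫_ℂ := fun v w => by
      rw [← Submodule.inner_starProjection_left_eq_right,
        Submodule.starProjection_eq_self_iff.2 (Submodule.starProjection_apply_mem _ _)]
    have key : HasSum (fun i => (c i : ℂ) *
        ⟪f.sum fun x v => conj (m i x) • L.starProjection v,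
          f.sum fun x v => conj (m i x) • L.starProjection v⟫_ℂ)
        (f.sum fun x v => f.sum fun y w =>
          ⟪(Matrix.of fun x y => k x y • L.starProjection) y x v, w⟫_ℂ) := by
      simp only [Finsupp.sum, sum_inner, inner_sum, Finset.mul_sum]
      rw [Finset.sum_comm]
      refine hasSum_sum fun y _ => hasSum_sum fun x _ => ?_
      have := (hk x y).mul_right ⟪L.starProjection (f x), f y⟫_ℂ
      simp only [Matrix.of_apply, FunLike.coe_smul, Pi.smul_apply, inner_smul_left,
        inner_smul_right, hconj, RCLike.conj_conj, ← hP]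
      convert! this using 2 with i
      ring
    refine (Complex.hasSum_re key).nonneg fun i => ?_
    rw [Complex.re_ofReal_mul]
    exact mul_nonneg (hc i) (inner_self_nonneg (𝕜 := ℂ))

end IsDiagonalKernel

/-! ### The multivariate negative binomial series -/

section MultivariateBinomial

variable {d : ℕ}

lemma hasSum_fiber_sum_eq {M : Type*} [AddCommMonoid M] [TopologicalSpace M]
    (F : (Fin d → ℕ) → M) (n : ℕ) :
    HasSum (fun α : {α : Fin d → ℕ // ∑ j, α j = n} => F α)
      (∑ α ∈ Finset.piAntidiag Finset.univ n, F α) := by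
  have e : ∀ α : Fin d → ℕ, ∑ j, α j = n ↔ α ∈ Finset.piAntidiag Finset.univ n := by simp
  rw [← (Equiv.subtypeEquivRight e).symm.hasSum_iff]
  exact (Finset.piAntidiag Finset.univ n).hasSum F

/-- The terms of the multivariate binomial series of `(1 - ∑ x_i)^(-(b + 1))`. -/
def binomialTerm {𝕜 : Type*} [RCLike 𝕜] (b : ℕ) (x : Fin d → 𝕜) (α : Fin d → ℕ) : 𝕜 :=
  (1 / ∏ i, ((α i).factorial : 𝕜)) *
    (∏ i ∈ Finset.range (∑ j, α j), ((b + 1 : ℕ) + i : 𝕜)) * ∏ i, x i ^ α i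

/-- The multinomial theorem, since `(b+1)⋯(b+n) = n! (n+b choose b)` and `n!/α!` is the multinomial
coefficient. Grouping by total degree thus reduces the series to one variable. -/
lemma sum_piAntidiag_binomialTerm {𝕜 : Type*} [RCLike 𝕜] (b : ℕ) (x : Fin d → 𝕜) (n : ℕ) :
    ∑ α ∈ Finset.piAntidiag Finset.univ n, binomialTerm b x α =
    ((n + b).choose b : 𝕜) * (∑ i, x i) ^ n := by
  rw [Finset.sum_pow_eq_sum_piAntidiag, Finset.mul_sum]
  refine Finset.sum_congr rfl fun α hα => ?_
  have hα : ∑ j, α j = n := by simpa using hα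
  have h1 : (∏ i ∈ Finset.range n, ((b + 1 : ℕ) + i : 𝕜)) =
      (n.factorial : 𝕜) * ((n + b).choose b : 𝕜) := by
    have h := (Nat.ascFactorial_eq_prod_range (b + 1) n).symm.trans
      (Nat.ascFactorial_eq_factorial_mul_choose b n)
    rw [add_comm b n, Nat.choose_symm_add] at h
    exact_mod_cast congrArg (Nat.cast : ℕ → 𝕜) h
  have h2 : (∏ i, ((α i).factorial : 𝕜)) * (Nat.multinomial Finset.univ α : 𝕜) =
      (n.factorial : 𝕜) := by
    have h := Nat.multinomial_spec Finset.univ α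
    rw [hα] at h
    exact_mod_cast congrArg (Nat.cast : ℕ → 𝕜) h
  have h3 : (∏ i, ((α i).factorial : 𝕜)) ≠ 0 :=
    Finset.prod_ne_zero_iff.2 fun i _ => Nat.cast_ne_zero.2 (Nat.factorial_ne_zero _)
  rw [binomialTerm, hα, h1, ← h2]
  field_simp

lemma binomialTerm_nonneg (b : ℕ) {x : Fin d → ℝ} (hx : ∀ i, 0 ≤ x i) (α : Fin d → ℕ) :
    0 ≤ binomialTerm b x α := by
  have : 0 ≤ ∏ i, x i ^ α i := Finset.prod_nonneg fun i _ => pow_nonneg (hx i) _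
  unfold binomialTerm
  positivity

lemma norm_binomialTerm (b : ℕ) (x : Fin d → ℂ) (α : Fin d → ℕ) :
    ‖binomialTerm b x α‖ = binomialTerm b (fun i => ‖x i‖) α := by
  have h : ∀ i : ℕ, ‖((b + 1 : ℕ) + i : ℂ)‖ = ((b + 1 : ℕ) + i : ℝ) := fun i => by
    rw [← Nat.cast_add, ← Nat.cast_add, Complex.norm_natCast]
  simp only [binomialTerm, norm_mul, norm_div, norm_prod, norm_pow, norm_one,
    Complex.norm_natCast, h]

lemma hasSum_of_summable_binomialTerm {𝕜 : Type*} [RCLike 𝕜] (b : ℕ) (x : Fin d → 𝕜)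
    (hs : Summable (binomialTerm b x)) :
    HasSum (fun n : ℕ => ((n + b).choose b : 𝕜) * (∑ i, x i) ^ n) (∑' α, binomialTerm b x α) := by
  have h1 := ((Equiv.sigmaFiberEquiv fun α : Fin d → ℕ => ∑ j, α j).hasSum_iff.2 hs.hasSum).sigma
    fun n => hasSum_fiber_sum_eq (binomialTerm b x) n
  simpa only [sum_piAntidiag_binomialTerm b x] using h1

lemma summable_binomialTerm (b : ℕ) (x : Fin d → ℝ) (hx0 : ∀ i, 0 ≤ x i)
    (hx : ∑ i, x i < 1) : Summable (binomialTerm b x) := by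
  rw [← (Equiv.sigmaFiberEquiv fun α : Fin d → ℕ => ∑ j, α j).summable_iff]
  refine (summable_sigma_of_nonneg fun p => binomialTerm_nonneg b hx0 _).2 ⟨fun n => ?_, ?_⟩
  · exact (hasSum_fiber_sum_eq (binomialTerm b x) n).summable
  · have hx' : ‖∑ i, x i‖ < 1 := by
      rwa [Real.norm_of_nonneg (Finset.sum_nonneg fun i _ => hx0 i)]
    refine (summable_choose_mul_geometric_of_norm_lt_one b hx').congr fun n => ?_
    rw [← sum_piAntidiag_binomialTerm b x n]
    exact (hasSum_fiber_sum_eq (binomialTerm b x) n).tsum_eq.symm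

/-- The multivariate binomial series. -/
lemma tsum_binomialTerm (b : ℕ) (x : Fin d → ℂ) (hx : ∑ i, ‖x i‖ < 1) :
    ∑' α, binomialTerm b x α = 1 / (1 - ∑ i, x i) ^ (b + 1) := by
  have hs : Summable (binomialTerm b x) :=
    ((summable_binomialTerm b _ (fun i => norm_nonneg _) hx).congr
      fun α => (norm_binomialTerm b x α).symm).of_norm
  exact (hasSum_of_summable_binomialTerm b x hs).unique
    (hasSum_choose_mul_geometric_of_norm_lt_one b ((norm_sum_le _ _).trans_lt hx))

end MultivariateBinomial

/-! ### The scalar kernels on the ball -/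

namespace TreeModule

variable {d : ℕ}

/-- The monomials as functions on the ball. -/
def monomialFun (α : Fin d → ℕ) (z : UnitBall d) : ℂ := ∏ i, z.1 i ^ α i

/-- The coefficients of `scalarKernel`. -/
def kernelCoeff (a : ℕ) (β α : Fin d → ℕ) : ℝ :=
  (∏ i, ((β i).factorial : ℝ)) / (∏ i, ((β i + α i).factorial : ℝ)) *
    ∏ i ∈ Finset.range (∑ j, α j), ((∑ j, β j : ℕ) + a + i : ℝ)

lemma kernelCoeff_nonneg (a : ℕ) (β α : Fin d → ℕ) : 0 ≤ kernelCoeff a β α := by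
  unfold kernelCoeff
  positivity

lemma scalarKernel_eq (a : ℕ) (β : Fin d → ℕ) (z w : UnitBall d) :
    scalarKernel a β z w =
      ∑' α, (kernelCoeff a β α : ℂ) * (monomialFun α z * conj (monomialFun α w)) := by
  simp [scalarKernel, kernelCoeff, monomialFun]

lemma sum_norm_mul_conj_lt_one (z w : UnitBall d) : ∑ i, ‖z.1 i * conj (w.1 i)‖ < 1 := by
  have hz : ‖z.1‖ < 1 := mem_ball_zero_iff.1 z.2
  have hw : ‖w.1‖ < 1 := mem_ball_zero_iff.1 w.2
  have h := Finset.sum_mul_sq_le_sq_mul_sq Finset.univ (fun i => ‖z.1 i‖) fun i => ‖w.1 i‖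
  rw [← EuclideanSpace.norm_sq_eq, ← EuclideanSpace.norm_sq_eq, ← mul_pow] at h
  simp only [norm_mul, RCLike.norm_conj]
  calc _ ≤ ‖z.1‖ * ‖w.1‖ := le_of_sq_le_sq h (by positivity)
    _ < 1 := mul_lt_one_of_nonneg_of_lt_one_left (norm_nonneg _) hz hw.le

/-- `α! β!` divides `(α + β)!`. The bound is the coefficient of the binomial series with exponent
`|β| + a`, which gives absolute convergence on the ball. -/
lemma kernelCoeff_le (a : ℕ) (β α : Fin d → ℕ) :
    kernelCoeff a β α ≤ (1 / ∏ i, ((α i).factorial : ℝ)) *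
      ∏ i ∈ Finset.range (∑ j, α j), ((∑ j, β j : ℕ) + a + i : ℝ) := by
  unfold kernelCoeff
  refine mul_le_mul_of_nonneg_right ?_ (by positivity)
  rw [div_le_div_iff₀ (by positivity) (by positivity), one_mul, ← Finset.prod_mul_distrib]
  refine Finset.prod_le_prod (fun i _ => by positivity) fun i _ => ?_
  exact_mod_cast Nat.le_of_dvd (Nat.factorial_pos _) (Nat.factorial_mul_factorial_dvd_factorial_add _ _)

lemma hasSum_scalarKernel {a : ℕ} (ha : 0 < a) (β : Fin d → ℕ) (z w : UnitBall d) :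
    HasSum (fun α => (kernelCoeff a β α : ℂ) * (monomialFun α z * conj (monomialFun α w)))
      (scalarKernel a β z w) := by
  rw [scalarKernel_eq]
  refine Summable.hasSum (.of_norm_bounded (summable_binomialTerm (∑ j, β j + a - 1)
    (fun i => ‖z.1 i * conj (w.1 i)‖) (fun i => norm_nonneg _)
    (sum_norm_mul_conj_lt_one z w)) fun α => ?_)
  rw [binomialTerm, Nat.sub_add_cancel (by omega), norm_mul, Complex.norm_real,
    Real.norm_of_nonneg (kernelCoeff_nonneg a β α)]
  refine mul_le_mul ((kernelCoeff_le a β α).trans_eq (by push_cast; rfl)) (le_of_eq ?_)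
    (norm_nonneg _) (by positivity)
  simp [monomialFun, Finset.prod_mul_distrib, mul_pow]

lemma isDiagonalKernel_scalarKernel {a : ℕ} (ha : 0 < a) (β : Fin d → ℕ) :
    IsDiagonalKernel monomialFun (scalarKernel (d := d) a β) :=
  ⟨_, kernelCoeff_nonneg a β, hasSum_scalarKernel ha β⟩

lemma monomialFun_add_single (α : Fin d → ℕ) (k : Fin d) (z : UnitBall d) :
    monomialFun (α + Pi.single k 1) z = z.1 k * monomialFun α z := by
  simp only [monomialFun, Pi.add_apply, pow_add, Finset.prod_mul_distrib]
  rw [mul_comm]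
  congr 1
  rw [Finset.prod_eq_single k] <;> simp +contextual

/-- The quotient of the two coefficients is `(|β| + a + |α|) / (β_k + α_k + 1)`, which is at least
`1` because `a ≥ 1`. -/
lemma kernelCoeff_le_add_single {a : ℕ} (ha : 0 < a) (β α : Fin d → ℕ) (k : Fin d) :
    kernelCoeff a β α ≤ kernelCoeff a β (α + Pi.single k 1) := by
  have h1 : ∑ j, (α + Pi.single k 1 : Fin d → ℕ) j = ∑ j, α j + 1 := by
    simp [Finset.sum_add_distrib]
  have h2 : (∏ i, ((β i + (α + Pi.single k 1 : Fin d → ℕ) i).factorial : ℝ)) =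
      (β k + α k + 1) * ∏ i, ((β i + α i).factorial : ℝ) := by
    have h : ∀ i, ((β i + (α + Pi.single k 1 : Fin d → ℕ) i).factorial : ℝ) =
        (if i = k then (β k + α k + 1 : ℝ) else 1) * ((β i + α i).factorial : ℝ) := by
      intro i
      by_cases h : i = k
      · subst h
        simp [← add_assoc, Nat.factorial_succ]
      · simp [h]
    rw [Finset.prod_congr rfl fun i _ => h i, Finset.prod_mul_distrib]
    simp
  unfold kernelCoeff
  rw [h1, Finset.prod_range_succ, h2]
  set P : ℝ := ∏ i, ((β i + α i).factorial : ℝ) with hP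
  have hP0 : 0 < P := by positivity
  have hb : β k ≤ ∑ j, β j := Finset.single_le_sum (fun _ _ => Nat.zero_le _) (Finset.mem_univ k)
  have hα : α k ≤ ∑ j, α j := Finset.single_le_sum (fun _ _ => Nat.zero_le _) (Finset.mem_univ k)
  have hle : (β k + α k + 1 : ℝ) ≤ (∑ j, β j : ℕ) + a + (∑ j, α j : ℕ) := by
    have : β k + α k + 1 ≤ ∑ j, β j + a + ∑ j, α j := by omega
    exact_mod_cast this
  set Q : ℝ := ∏ i ∈ Finset.range (∑ j, α j), ((∑ j, β j : ℕ) + a + i : ℝ)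
  set B : ℝ := ∏ i, ((β i).factorial : ℝ)
  have hQ : 0 ≤ Q := by positivity
  have hB : 0 ≤ B := by positivity
  set t : ℝ := β k + α k + 1
  have ht : 0 < t := by positivity
  calc B / P * Q = B / (t * P) * (Q * t) := by field_simp
    _ ≤ _ := by gcongr

lemma isDiagonalKernel_sub_mul {a : ℕ} (ha : 0 < a) (β : Fin d → ℕ) (k : Fin d) :
    IsDiagonalKernel monomialFun fun z w : UnitBall d =>
      (1 - z.1 k * conj (w.1 k)) * scalarKernel a β z w := by
  classical
  set σ : (Fin d → ℕ) → (Fin d → ℕ) := fun α => α + Pi.single k 1 with hσ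
  have hinj : Function.Injective σ := add_left_injective _
  -- Multiplication by `z_k conj w_k` shifts the coefficients by `σ`; multiindices with zero `k`-th
  -- entry receive `0`.
  set c : (Fin d → ℕ) → ℝ := Function.extend σ (kernelCoeff a β) 0 with hc
  refine ⟨fun α => kernelCoeff a β α - c α, fun α => ?_, fun z w => ?_⟩
  · rw [sub_nonneg, hc]
    by_cases h : ∃ γ, σ γ = α
    · obtain ⟨γ, rfl⟩ := h
      rw [hinj.extend_apply]
      exact kernelCoeff_le_add_single ha β γ k
    · rw [Function.extend_apply' _ _ _ h]
      exact kernelCoeff_nonneg a β α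
  · have h1 := hasSum_scalarKernel ha β z w
    have h2 : HasSum (fun α => (c α : ℂ) * (monomialFun α z * conj (monomialFun α w)))
        (z.1 k * conj (w.1 k) * scalarKernel a β z w) := by
      rw [← hinj.hasSum_iff]
      · convert! h1.mul_left (z.1 k * conj (w.1 k)) using 2 with α
        rw [Function.comp_apply, hc, hinj.extend_apply, hσ]
        simp only [monomialFun_add_single, map_mul]
        ring
      · intro α hα
        rw [hc, Function.extend_apply' _ _ _ (by simpa using hα)]
        simp
    convert! h1.sub h2 using 2 with α
    · push_cast
      ring
    · ring

lemma scalarKernel_zero {a : ℕ} (ha : 0 < a) (z w : UnitBall d) :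
    scalarKernel a 0 z w = 1 / (1 - ∑ i, z.1 i * conj (w.1 i)) ^ a := by
  obtain ⟨b, rfl⟩ := Nat.exists_eq_succ_of_ne_zero ha.ne'
  rw [Nat.succ_eq_add_one, ← tsum_binomialTerm b _ (sum_norm_mul_conj_lt_one z w)]
  simp [binomialTerm, scalarKernel, Finset.prod_mul_distrib, mul_pow]

/-- Only `α = 0` survives. This value, independent of `β`, turns `κ(0,0)` into a plain sum of
projections. -/
lemma scalarKernel_origin {a : ℕ} (β : Fin d → ℕ) {z : UnitBall d} (hz : z.1 = 0)
    (w : UnitBall d) : scalarKernel a β w z = 1 := by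
  rw [scalarKernel_eq, tsum_eq_single 0]
  · have : (∏ i, ((β i).factorial : ℝ)) ≠ 0 := by positivity
    simp [kernelCoeff, monomialFun, div_self this]
  · intro α hα
    obtain ⟨i, hi⟩ := Function.ne_iff.1 hα
    have : monomialFun α z = 0 := by
      refine Finset.prod_eq_zero (Finset.mem_univ i) ?_
      rw [hz]
      exact zero_pow hi
    simp [this]

end TreeModule

/-! ### Combinatorics of a single tree -/

namespace TreeModule

universe u

namespace RootedTree

variable {V : Type u} (T : RootedTree V)

/-- Reachability from the root passes along edges in both directions: backwards because parents are
unique and the root has none. -/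
lemma reflTransGen_root (v : V) : Relation.ReflTransGen T.Adj T.root v := by
  have key : ∀ a b, Relation.EqvGen T.Adj a b →
      ((Relation.ReflTransGen T.Adj T.root a) ↔ (Relation.ReflTransGen T.Adj T.root b)) := by
    intro a b h
    induction h with
    | rel a b h =>
      refine ⟨fun h1 => h1.tail h, fun h1 => ?_⟩
      rcases Relation.ReflTransGen.cases_tail h1 with h2 | ⟨c, hc, hcb⟩
      · subst h2
        exact absurd h (T.root_no_parent a)
      · rwa [T.parent_unique a c b h hcb]
    | refl a => exact Iff.rfl
    | symm a b _ ih => exact ih.symm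
    | trans a b c _ _ ih1 ih2 => exact ih1.trans ih2
  exact (key _ _ (T.connected T.root v)).1 .refl

lemma depth_root : T.depth T.root = 0 :=
  Nat.sInf_eq_zero.2 (Or.inl rfl)

lemma mem_descendants_depth (v : V) : v ∈ T.descendants T.root (T.depth v) := by
  refine Nat.sInf_mem (s := {n | v ∈ T.descendants T.root n}) ?_
  induction T.reflTransGen_root v with
  | refl => exact ⟨0, rfl⟩
  | tail _ h ih =>
    obtain ⟨n, hn⟩ := ih
    exact ⟨n + 1, _, hn, h⟩

lemma descendants_finite (v : V) (n : ℕ) : (T.descendants v n).Finite := by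
  induction n with
  | zero => exact Set.finite_singleton v
  | succ n ih =>
    refine (ih.biUnion fun u _ => T.locally_finite u).subset ?_
    rintro w ⟨u, hu, hw⟩
    exact Set.mem_biUnion hu hw

variable {T} in
lemma FiniteBranchingIndex.finite (h : T.FiniteBranchingIndex) : {v | T.IsBranching v}.Finite := by
  obtain ⟨N, hN⟩ := h
  refine ((Set.finite_Iic N).biUnion fun n _ => T.descendants_finite T.root n).subset ?_
  intro v hv
  exact Set.mem_biUnion (Set.mem_Iic.2 (hN (Set.mem_image_of_mem _ hv))) (T.mem_descendants_depth v)

variable {T} in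
lemma par_eq {u v : V} (h : T.Adj u v) : T.par v = u :=
  T.parent_unique _ _ _ (T.adj_par ⟨u, h⟩) h

variable {T} in
lemma sib_eq {u v : V} (h : T.Adj u v) : T.sib v = T.children u := by
  ext w
  constructor
  · rintro ⟨p, hp, hw⟩
    rwa [T.parent_unique u p v h hp]
  · exact fun hw => ⟨u, h, hw⟩

lemma ncard_children_pos (v : V) : 0 < (T.children v).ncard :=
  (Set.ncard_pos (T.locally_finite v)).2 (T.leafless v)

variable {T} in
lemma children_eq_of_not_isBranching {u v : V} (hu : ¬ T.IsBranching u) (h : T.Adj u v) :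
    T.children u = {v} := by
  have h1 : (T.children u).ncard ≤ 1 := by
    unfold IsBranching at hu
    omega
  exact Set.eq_singleton_iff_unique_mem.2
    ⟨h, fun w hw => (Set.ncard_le_one (T.locally_finite u)).1 h1 w hw v h⟩

/-- Without branching each vertex has a unique child `s v`, and `n ↦ s^[n] root` is the isomorphism:
injective since there are no circuits, surjective since every vertex is reachable from the root. -/
lemma graphIsomorphic_rayTree_iff :
    GraphIsomorphic T rayTree ↔ ∀ v, ¬ T.IsBranching v := by
  constructor
  · rintro ⟨e, he⟩ v hv
    refine rayTree_not_isBranching (e v) ?_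
    have : rayTree.children (e v) = e '' T.children v := by
      ext n
      obtain ⟨w, rfl⟩ := e.surjective n
      simp only [children, Set.mem_ofPred_eq, ← he, e.injective.mem_set_image]
    rw [IsBranching, this, Set.ncard_image_of_injective _ e.injective]
    exact hv
  · intro h
    choose s hs using T.leafless
    have hadj : ∀ u v, T.Adj u v ↔ v = s u := fun u v => by
      have := children_eq_of_not_isBranching (h u) (hs u)
      exact Set.ext_iff.1 this v
    have hlt : ∀ (v : V) (n : ℕ), Relation.TransGen T.Adj v (s^[n + 1] v) := by
      intro v n
      induction n with
      | zero => exact .single (hs v)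
      | succ n ih =>
        rw [Function.iterate_succ_apply']
        exact ih.tail (hs _)
    have hne : ∀ m n : ℕ, m < n → s^[m] T.root ≠ s^[n] T.root := by
      intro m n hmn heq
      obtain ⟨k, rfl⟩ := Nat.exists_eq_add_of_lt hmn
      have := hlt (s^[m] T.root) k
      rw [← Function.iterate_add_apply, show k + 1 + m = m + k + 1 by omega, ← heq] at this
      exact T.no_circuit _ this
    have hb : Function.Bijective fun n : ℕ => s^[n] T.root := by
      constructor
      · intro m n hmn
        rcases lt_trichotomy m n with hlt | heq | hgt
        · exact absurd hmn (hne _ _ hlt)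
        · exact heq
        · exact absurd hmn.symm (hne _ _ hgt)
      · intro v
        induction T.reflTransGen_root v with
        | refl => exact ⟨0, rfl⟩
        | @tail b c _ h ih =>
          obtain ⟨n, hn⟩ := ih
          refine ⟨n + 1, ?_⟩
          rw [(hadj _ _).1 h, ← hn]
          exact Function.iterate_succ_apply' _ _ _
    set e := Equiv.ofBijective _ hb with he
    refine ⟨e.symm, fun u v => ?_⟩
    obtain ⟨m, rfl⟩ := e.surjective u
    obtain ⟨n, rfl⟩ := e.surjective v
    rw [hadj, e.symm_apply_apply, e.symm_apply_apply]
    have : s (e m) = e (m + 1) := (Function.iterate_succ_apply' _ _ _).symm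
    rw [this, e.injective.eq_iff]
    rfl

end RootedTree

/-! ### Solution spaces in the product of the trees -/

section Product

variable {d : ℕ} {V : Fin d → Type u} (T : ∀ j, RootedTree (V j)) {a : ℕ}

lemma weight_pos (ha : 0 < a) (j : Fin d) (w : ∀ i, V i) : 0 < weight T (cSeq a d) j w := by
  have hd : 0 < d := j.pos
  have h := (T j).ncard_children_pos (parAt T j w j)
  unfold weight cSeq
  positivity

/-- Siblings carry equal weights, so differences of sibling basis vectors satisfy the linear
equations of a solution space. -/
lemma weight_congr (c : ℕ → ℝ) (j : Fin d) {w w' : ∀ i, V i} (h : parAt T j w = parAt T j w') :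
    weight T c j w = weight T c j w' := by
  unfold weight
  rw [h]

/-- The root of the product. -/
def rootVec : ∀ j, V j := fun j => (T j).root

lemma mdepth_rootVec : mdepth T (rootVec T) = 0 := by
  funext j
  exact (T j).depth_root

lemma mem_sibF_self {F : Finset (Fin d)} {u : ∀ i, V i} (hu : u ∈ Phi T F) : u ∈ sibF T F u := by
  refine ⟨fun j hj => ?_, fun _ _ => rfl⟩
  obtain ⟨p, hp⟩ := (T j).exists_parent ((hu j).2 hj)
  exact ⟨p, hp, hp⟩

lemma eq_root_of_mem_Phi {F : Finset (Fin d)} {u : ∀ i, V i} (hu : u ∈ Phi T F) {j : Fin d}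
    (hj : j ∉ F) : u j = (T j).root :=
  not_not.1 fun h => hj ((hu j).1 h)

/-- If `u j` has no sibling but itself, each equation in direction `j` has the single term `f(w)
λ_j(w)`, and `λ_j(w) > 0` forces `f(w) = 0`. -/
lemma isBranching_par_of_solutionSpace_ne_bot (ha : 0 < a) {F : Finset (Fin d)} {u : ∀ i, V i}
    (hu : u ∈ Phi T F) (hL : solutionSpace T a u F ≠ ⊥) {j : Fin d} (hj : j ∈ F) :
    (T j).IsBranching ((T j).par (u j)) := by
  by_contra hb
  refine hL ((Submodule.eq_bot_iff _).2 fun f hf => ?_)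
  have hp := (T j).adj_par ((T j).exists_parent ((hu j).2 hj))
  have hs : (T j).sib (u j) = {u j} :=
    (RootedTree.sib_eq hp).trans (RootedTree.children_eq_of_not_isBranching hb hp)
  ext w
  by_cases hw : w ∈ sibF T F u
  · have h := hf.2 j hj w hw
    have hsib : sibAt T j (Function.update (restrictTo T (F.erase j) w) j (u j)) = {w} := by
      have hwj : w j = u j := by simpa [hs] using hw.1 j hj
      have hr : Function.update (restrictTo T (F.erase j) w) j (u j) = w := by
        funext i
        by_cases hi : i = j
        · subst hi
          simp [hwj]
        · rw [Function.update_of_ne hi]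
          by_cases hiF : i ∈ F
          · simp [restrictTo, hi, hiF]
          · simp [restrictTo, hiF, hw.2 i hiF, eq_root_of_mem_Phi T hu hiF]
      rw [hr]
      ext v
      simp only [sibAt, hwj, hs, Set.mem_singleton_iff, Set.mem_ofPred_eq]
      refine ⟨fun hv => funext fun i => ?_, ?_⟩
      · by_cases hi : i = j
        · subst hi
          rw [hv.1, hwj]
        · exact hv.2 i hi
      · rintro rfl
        exact ⟨hwj, fun _ _ => rfl⟩
    simp only [hsib, Set.toFinite_toFinset, Set.toFinset_singleton, Finset.sum_singleton] at h
    have h0 : (weight T (cSeq a d) j w : ℂ) ≠ 0 := by exact_mod_cast (weight_pos T ha j w).ne'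
    simpa [h0] using h
  · simpa using hf.1 w hw

lemma finite_omega_solutionSpace_ne_bot (ha : 0 < a) (hT : ∀ j, (T j).FiniteBranchingIndex)
    (F : Finset (Fin d)) : {u | u ∈ Omega T F ∧ solutionSpace T a u F ≠ ⊥}.Finite := by
  refine (Set.Finite.pi (t := fun j => {(T j).root} ∪
    ⋃ p ∈ {p | (T j).IsBranching p}, (T j).children p) fun j =>
      (Set.finite_singleton _).union ((hT j).finite.biUnion
        fun p _ => (T j).locally_finite p)).subset ?_
  rintro u ⟨hu, hL⟩ j -
  by_cases hj : j ∈ F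
  · exact Or.inr (Set.mem_biUnion (isBranching_par_of_solutionSpace_ne_bot T ha hu.1 hL hj)
      ((T j).adj_par ((T j).exists_parent ((hu.1 j).2 hj))))
  · exact Or.inl (eq_root_of_mem_Phi T hu.1 hj)

/-- A `finsum` with infinite support would be zero by convention. Here the support is finite: a
nonzero `L_{u,F}` forces each coordinate of `u` to be a root or a child of one of finitely many
branching vertices. -/
lemma exists_treeKernel_eq (ha : 0 < a) (hT : ∀ j, (T j).FiniteBranchingIndex) :
    ∃ s : Finset (Σ _ : Finset (Fin d), ∀ i, V i),
      (∀ F u, ⟨F, u⟩ ∈ s ↔ u ∈ Omega T F ∧ solutionSpace T a u F ≠ ⊥) ∧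
      ∀ z w, treeKernel T a z w =
        ∑ p ∈ s, scalarKernel a (mdepth T p.2) z w • (solutionSpace T a p.2 p.1).starProjection := by
  refine ⟨Finset.univ.sigma fun F => (finite_omega_solutionSpace_ne_bot T ha hT F).toFinset,
    by simp, fun z w => ?_⟩
  rw [Finset.sum_sigma, treeKernel, Matrix.of_apply]
  refine Finset.sum_congr rfl fun F _ => ?_
  refine finsum_mem_eq_sum_of_subset
    (fun u => scalarKernel a (mdepth T u) z w • (solutionSpace T a u F).starProjection)
    (fun u hu => ?_) (fun u hu => ?_)
  · simp only [Set.Finite.coe_toFinset]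
    refine ⟨hu.1, fun h => hu.2 ?_⟩
    simp [h]
  · simp only [Set.Finite.coe_toFinset] at hu
    exact hu.1

lemma mem_jointKernel_iff (f : L2 V) :
    f ∈ jointKernel T a ↔ ∀ (j : Fin d) (g : L2 V), ⟪shift T a j g, f⟫_ℂ = 0 := by
  simp only [jointKernel, Submodule.mem_iInf]
  refine forall_congr' fun j => ?_
  rw [LinearMap.mem_ker, ContinuousLinearMap.coe_coe, ext_iff_inner_left ℂ]
  simp [ContinuousLinearMap.adjoint_inner_right]

lemma shift_apply (j : Fin d) (g : L2 V) (w : ∀ i, V i) :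
    shift T a j g w = shiftFun T a j g w := rfl

open Classical in
/-- The basis vector at the root, as an element of the joint kernel. -/
def rootElement (a : ℕ) : jointKernel T a :=
  ⟨lp.single 2 (rootVec T) 1, by
    rw [mem_jointKernel_iff]
    intro j g
    rw [lp.inner_single_right, shift_apply, shiftFun, if_pos (by rfl), inner_zero_left]⟩

lemma rootElement_apply_root : (rootElement T a : L2 V) (rootVec T) = 1 := by
  simp [rootElement]

lemma rootElement_apply_of_ne {w : ∀ i, V i} (hw : w ≠ rootVec T) :
    (rootElement T a : L2 V) w = 0 := by
  simp [rootElement, hw]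

lemma inner_rootElement (f : jointKernel T a) :
    ⟪rootElement T a, f⟫_ℂ = (f : L2 V) (rootVec T) := by
  classical
  rw [Submodule.coe_inner, rootElement, lp.inner_single_left]
  simp

lemma mem_sibF_empty_iff {u w : ∀ i, V i} : w ∈ sibF T ∅ u ↔ w = u := by
  simp [sibF, funext_iff]

lemma mem_solutionSpace_empty_iff {u : ∀ i, V i} {f : jointKernel T a} :
    f ∈ solutionSpace T a u ∅ ↔ ∀ w, w ≠ u → (f : L2 V) w = 0 := by
  refine ⟨fun h w hw => h.1 w ((mem_sibF_empty_iff T).not.2 hw), fun h =>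
    ⟨fun w hw => h w ((mem_sibF_empty_iff T).not.1 hw), by simp⟩⟩

lemma mem_omega_empty_iff {u : ∀ i, V i} : u ∈ Omega T ∅ ↔ u = rootVec T := by
  refine ⟨fun h => funext fun j => eq_root_of_mem_Phi T h.1 (Finset.notMem_empty j), ?_⟩
  rintro rfl
  exact ⟨fun j => by simp [rootVec], fun h => (mem_sibF_empty_iff T).1 h.some_mem⟩

lemma rootElement_mem_solutionSpace : rootElement T a ∈ solutionSpace T a (rootVec T) ∅ :=
  (mem_solutionSpace_empty_iff T).2 fun _ hw => rootElement_apply_of_ne T hw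

lemma solutionSpace_rootVec_eq_span :
    solutionSpace T a (rootVec T) ∅ = Submodule.span ℂ {rootElement T a} := by
  refine le_antisymm (fun f hf => ?_) ?_
  · refine Submodule.mem_span_singleton.2 ⟨(f : L2 V) (rootVec T), ?_⟩
    ext w
    by_cases hw : w = rootVec T
    · subst hw
      simp [rootElement_apply_root]
    · simp [rootElement_apply_of_ne T hw, (mem_solutionSpace_empty_iff T).1 hf w hw]
  · rw [Submodule.span_singleton_le_iff_mem]
    exact rootElement_mem_solutionSpace T

/-- Take `f = e_u - e_{u'}`, where `u j` and `u' j` are two children of `p` and all other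
coordinates are roots. -/
lemma exists_mem_solutionSpace_singleton {j : Fin d} {p : V j} (hp : (T j).IsBranching p) :
    ∃ u ∈ Omega T {j}, ∃ f ∈ solutionSpace T a u {j}, f ≠ 0 ∧ (f : L2 V) (rootVec T) = 0 := by
  classical
  obtain ⟨c, hc⟩ := (T j).leafless p
  have hroot : ∀ {v}, (T j).Adj p v → v ≠ (T j).root := fun h e =>
    (T j).root_no_parent p (e ▸ h)
  have hsibF : ∀ v, (T j).Adj p v → ∀ w, w ∈ sibF T {j} (Function.update (rootVec T) j v) ↔
      (T j).Adj p (w j) ∧ ∀ i, i ≠ j → w i = (T i).root := by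
    intro v hv w
    simp only [sibF, Finset.mem_singleton, forall_eq, Function.update_self,
      RootedTree.sib_eq hv, RootedTree.children, Set.mem_ofPred_eq]
    refine and_congr_right fun _ => forall_congr' fun i => forall_congr' fun hi => ?_
    rw [Function.update_of_ne hi, rootVec]
  have hne : (sibF T {j} (Function.update (rootVec T) j c)).Nonempty :=
    ⟨Function.update (rootVec T) j c, (hsibF c hc _).2 ⟨by simpa using hc, fun i hi => by simp [hi, rootVec]⟩⟩
  -- `Omega` contains only the chosen representative of a class, so `u` must be that choice and not
  -- the vertex built from `c`.
  obtain ⟨u, hu⟩ : ∃ u, u = hne.some := ⟨_, rfl⟩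
  obtain ⟨hu1, hu2⟩ := (hsibF c hc u).1 (hu ▸ hne.some_mem)
  have hu3 : u = Function.update (rootVec T) j (u j) := by
    funext i
    by_cases hi : i = j
    · subst hi
      simp
    · simp [hi, hu2 i hi, rootVec]
  have hsib : ∀ w, w ∈ sibF T {j} u ↔ (T j).Adj p (w j) ∧ ∀ i, i ≠ j → w i = (T i).root := by
    rw [hu3]
    exact hsibF _ hu1
  have hsame : sibF T {j} u = sibF T {j} (Function.update (rootVec T) j c) := by
    ext w
    rw [hsib, hsibF c hc]
  have hPhi : u ∈ Phi T {j} := fun i => by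
    by_cases hi : i = j
    · subst hi
      simp [hroot hu1]
    · simp [hi, hu2 i hi]
  have hOmega : u ∈ Omega T {j} := by
    refine ⟨hPhi, ?_⟩
    rw [hsame]
    exact fun _ => hu.symm
  obtain ⟨c', hc', hcu⟩ : ∃ c', (T j).Adj p c' ∧ c' ≠ u j :=
    Set.exists_ne_of_one_lt_ncard (s := (T j).children p) hp (u j)
  set u' := Function.update u j c' with hu'
  have hu'j : u' j = c' := by simp [hu']
  have hu'i : ∀ i, i ≠ j → u' i = u i := fun i hi => by simp [hu', hi]
  have huu' : u ≠ u' := fun h => hcu (by rw [← hu'j, ← h])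
  have hpar : parAt T j u = parAt T j u' := by
    simp [parAt, hu', RootedTree.par_eq hu1, RootedTree.par_eq hc']
  have hur : u ≠ rootVec T := fun h => hroot hu1 (congrFun h j)
  have hu'r : u' ≠ rootVec T := fun h => hroot hc' (by rw [← hu'j, h]; rfl)
  set f : L2 V := lp.single 2 u (1 : ℂ) - lp.single 2 u' 1 with hf
  have hfapp : ∀ w, f w = (if w = u then 1 else 0) - (if w = u' then 1 else 0) := fun w => by
    simp [hf, Pi.single_apply]
  -- In direction `j` the parents and weights of `u` and `u'` agree and the terms cancel; in any
  -- other direction both coordinates are roots, where the shift vanishes.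
  have hfE : f ∈ jointKernel T a := by
    rw [mem_jointKernel_iff]
    intro i g
    rw [hf, inner_sub_right, lp.inner_single_right, lp.inner_single_right, shift_apply,
      shift_apply, shiftFun, shiftFun]
    by_cases hi : i = j
    · subst hi
      rw [hu'j, if_neg (hroot hu1), if_neg (hroot hc'), hpar, weight_congr T _ i hpar, sub_self]
    · rw [hu'i i hi, if_pos (hu2 i hi)]
      simp [hu2 i hi]
  refine ⟨u, hOmega, ⟨f, hfE⟩, ⟨fun w hw => ?_, fun i hi v hv => ?_⟩, fun h => ?_, ?_⟩
  · have h1 : w ≠ u := by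
      rintro rfl
      exact hw (mem_sibF_self T hPhi)
    have h2 : w ≠ u' := by
      rintro rfl
      refine hw ((hsib _).2 ⟨by rwa [hu'j], fun i hi => by rw [hu'i i hi, hu2 i hi]⟩)
    simp [hfapp, h1, h2]
  · obtain rfl : i = j := by simpa using hi
    set S := (sibAt_finite T i
      (Function.update (restrictTo T (Finset.erase {i} i) v) i (u i))).toFinset
    have hS : ∀ w, w ∈ S ↔ (T i).Adj p (w i) ∧ ∀ k, k ≠ i → w k = (T k).root := fun w => by
      simp only [S, Set.Finite.mem_toFinset, sibAt, Set.mem_ofPred_eq, Function.update_self,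
        RootedTree.sib_eq hu1, RootedTree.children]
      refine and_congr_right fun _ => forall_congr' fun k => forall_congr' fun hk => ?_
      simp [restrictTo, hk]
    have h1 : u ∈ S := (hS u).2 ⟨hu1, hu2⟩
    have h2 : u' ∈ S := (hS u').2 ⟨by rwa [hu'j], fun k hk => by rw [hu'i k hk, hu2 k hk]⟩
    simp only [hfapp, sub_mul, Finset.sum_sub_distrib, ite_mul, one_mul, zero_mul,
      Finset.sum_ite_eq', h1, h2, if_true, weight_congr T _ i hpar, sub_self]
  · have h0 : f u = 0 := by
      have := congrArg (fun g : jointKernel T a => (g : L2 V) u) h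
      simpa using this
    simp [hfapp, huu'] at h0
  · simp [hfapp, hur.symm, hu'r.symm]

end Product

end TreeModule

namespace TreeModule

universe u

/-! ### Modules whose kernel is a sum of scalar kernels times projections -/

section Kernels

variable {d a : ℕ} {E : Type*} [NormedAddCommGroup E] [InnerProductSpace ℂ E] [CompleteSpace E]

lemma posSemidef_sum_smul_starProjection {ι A X : Type*} {m : A → X → ℂ} (s : Finset ι)
    (k : ι → X → X → ℂ) (hk : ∀ i, IsDiagonalKernel m (k i)) (L : ι → Submodule ℂ E)
    [∀ i, (L i).HasOrthogonalProjection] :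
    (Matrix.of fun x y => ∑ i ∈ s, k i x y • (L i).starProjection).PosSemidef := by
  have h : (Matrix.of fun x y => ∑ i ∈ s, k i x y • (L i).starProjection) =
      ∑ i ∈ s, Matrix.of fun x y => k i x y • (L i).starProjection := by
    ext x y : 2
    simp [Matrix.sum_apply]
  rw [h]
  exact Matrix.posSemidef_sum s fun i _ => (hk i).posSemidef_smul (L i)

omit [CompleteSpace E] in
-- Each `⟨P v, v⟩ = ‖P v‖²` is nonnegative, so mutual orthogonality of the subspaces is not needed.
lemma norm_starProjection_sq_le {ι : Type*} (s : Finset ι) (L : ι → Submodule ℂ E)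
    [∀ i, (L i).HasOrthogonalProjection] {i : ι} (hi : i ∈ s) (v : E) :
    ‖(L i).starProjection v‖ ^ 2 ≤ RCLike.re ⟪(∑ i ∈ s, (L i).starProjection) v, v⟫_ℂ := by
  have h : RCLike.re ⟪(∑ i ∈ s, (L i).starProjection) v, v⟫_ℂ =
      ∑ i ∈ s, ‖(L i).starProjection v‖ ^ 2 := by
    rw [sum_apply, sum_inner, map_sum]
    refine Finset.sum_congr rfl fun i _ => ?_
    rw [← inner_self_eq_norm_sq (𝕜 := ℂ), ← Submodule.inner_starProjection_left_eq_right,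
      Submodule.starProjection_eq_self_iff.2 (Submodule.starProjection_apply_mem _ _)]
  rw [h]
  exact Finset.single_le_sum (f := fun i => ‖(L i).starProjection v‖ ^ 2)
    (fun _ _ => sq_nonneg _) hi

variable (H : Type*) [NormedAddCommGroup H] [InnerProductSpace ℂ H] [CompleteSpace H]
  [RKHS ℂ H (UnitBall d) E]

lemma isHilbertModule_of_kernel_eq (ha : 0 < a) {ι : Type*} (s : Finset ι)
    (β : ι → Fin d → ℕ) (L : ι → Submodule ℂ E) [∀ i, (L i).HasOrthogonalProjection]
    (hK : ∀ z w, RKHS.kernel H z w = ∑ i ∈ s, scalarKernel a (β i) z w • (L i).starProjection) :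
    IsHilbertModule H := by
  intro k f
  refine RKHS.exists_smul_of_posSemidef (fun z => z.1 k) ?_ f
  simp only [hK, Finset.smul_sum, smul_smul]
  exact posSemidef_sum_smul_starProjection s
    (fun i z w => (1 - z.1 k * conj (w.1 k)) * scalarKernel a (β i) z w)
    (fun i => isDiagonalKernel_sub_mul ha (β i) k) L

/-- The centre of the ball. -/
def origin (d : ℕ) : UnitBall d := ⟨0, by simp⟩

variable {H} in
lemma inner_coordMul_kerFun_origin (h : IsHilbertModule H) (k : Fin d) (g : H) (v : E) :
    ⟪coordMul h k g, RKHS.kerFun H (origin d) v⟫_ℂ = 0 := by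
  simp [coordMul_apply, origin]

end Kernels

/-! ### The joint kernel of the adjoints in `H_a` -/

section Classical

variable {d a : ℕ}

/-- The one-term sum has the shape of the tree kernel, so both spaces share the arguments for
positivity and invariance. -/
lemma classicalKernel_eq (ha : 0 < a) (z w : UnitBall d) :
    classicalKernel d a z w =
      ∑ _i ∈ {()}, scalarKernel a 0 z w • (⊤ : Submodule ℂ ℂ).starProjection := by
  rw [Finset.sum_singleton, scalarKernel_zero ha, Submodule.starProjection_top']
  rfl

lemma posSemidef_classicalKernel (ha : 0 < a) : (classicalKernel d a).PosSemidef := by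
  have h : classicalKernel d a = Matrix.of fun z w =>
      ∑ _i ∈ {()}, scalarKernel a 0 z w • (⊤ : Submodule ℂ ℂ).starProjection := by
    ext z w : 1
    exact classicalKernel_eq ha z w
  rw [h]
  exact posSemidef_sum_smul_starProjection _ _ (fun _ => isDiagonalKernel_scalarKernel ha 0) _

variable {H : Type*} [NormedAddCommGroup H] [InnerProductSpace ℂ H] [CompleteSpace H]
  [RKHS ℂ H (UnitBall d) ℂ]

/-- The joint kernel of the adjoints of the coordinate multiplications on `H_a` consists of
constant functions. -/
lemma apply_eq_apply_origin (hK : RKHS.kernel H = classicalKernel d a) (h : IsHilbertModule H)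
    {f : H} (hf : ∀ k g, ⟪coordMul h k g, f⟫_ℂ = 0) (w : UnitBall d) : f w = f (origin d) := by
  -- `A` multiplies by `⟨z,w⟩` and its range is orthogonal to `f`. Hence `f(w) = ⟨k_w, f⟩ = ⟨(1 -
  -- A)^a k_w, f⟩`, and `(1 - A)^a k_w = 1 = k_0`.
  set A : H →L[ℂ] H := ∑ k, conj (w.1 k) • coordMul h k with hA
  have hAapp : ∀ (g : H) (z : UnitBall d),
      (A g) z = (∑ k, z.1 k * conj (w.1 k)) * g z := by
    intro g z
    have h1 : A g = ∑ k, conj (w.1 k) • coordMul h k g := by simp [hA]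
    have h2 : ∀ s : Finset (Fin d), (∑ k ∈ s, conj (w.1 k) • coordMul h k g : H) z =
        (∑ k ∈ s, z.1 k * conj (w.1 k)) * g z := by
      intro s
      classical
      induction s using Finset.induction_on with
      | empty => simp
      | insert k s hk ih =>
        rw [Finset.sum_insert hk, Finset.sum_insert hk, RKHS.coe_add, Pi.add_apply, ih,
          RKHS.coe_smul, Pi.smul_apply, coordMul_apply, smul_eq_mul, smul_eq_mul]
        ring
    rw [h1, h2]
  have hAinner : ∀ g, ⟪A g, f⟫_ℂ = 0 := fun g => by
    have h1 : A g = ∑ k, conj (w.1 k) • coordMul h k g := by simp [hA]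
    rw [h1, sum_inner]
    exact Finset.sum_eq_zero fun k _ => by rw [inner_smul_left, hf, mul_zero]
  set B : ℕ → H := fun n => (fun g => g - A g)^[n] (RKHS.kerFun H w 1) with hB
  have hBsucc : ∀ n, B (n + 1) = B n - A (B n) := fun n => Function.iterate_succ_apply' _ _ _
  have hBinner : ∀ n, ⟪B n, f⟫_ℂ = f w := by
    intro n
    induction n with
    | zero => simp [hB]
    | succ n ih => rw [hBsucc, inner_sub_left, hAinner, sub_zero, ih]
  have hBapp : ∀ n z, B n z =
      (1 - ∑ k, z.1 k * conj (w.1 k)) ^ n * (classicalKernel d a z w 1) := by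
    intro n z
    induction n with
    | zero => simp [hB, RKHS.kerFun_apply, hK]
    | succ n ih =>
      rw [hBsucc, RKHS.coe_sub, Pi.sub_apply, hAapp, ih]
      ring
  have hBa : B a = RKHS.kerFun H (origin d) 1 := by
    refine RKHS.ext fun z => ?_
    have hlt : ‖∑ k, z.1 k * conj (w.1 k)‖ < 1 :=
      (norm_sum_le _ _).trans_lt (sum_norm_mul_conj_lt_one z w)
    have hne : 1 - ∑ k, z.1 k * conj (w.1 k) ≠ 0 := fun h0 => by
      rw [← sub_eq_zero.1 h0, norm_one] at hlt
      exact lt_irrefl _ hlt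
    rw [hBapp, RKHS.kerFun_apply, hK]
    simp [classicalKernel, origin, hne]
  rw [← hBinner a, hBa, RKHS.kerFun_inner]
  simp

end Classical

/-! ### Comparison of the two modules -/

section Tree

variable {d a : ℕ} {V : Fin d → Type u} {T : ∀ j, RootedTree (V j)}

lemma posSemidef_treeKernel (ha : 0 < a) (hT : ∀ j, (T j).FiniteBranchingIndex) :
    (treeKernel T a).PosSemidef := by
  obtain ⟨s, -, hs⟩ := exists_treeKernel_eq T ha hT
  have h : treeKernel T a = Matrix.of fun z w => ∑ p ∈ s,
      scalarKernel a (mdepth T p.2) z w • (solutionSpace T a p.2 p.1).starProjection := by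
    ext z w : 1
    exact hs z w
  rw [h]
  exact posSemidef_sum_smul_starProjection s _ (fun p => isDiagonalKernel_scalarKernel ha _)
    fun p => solutionSpace T a p.2 p.1

variable {H : Type*} [NormedAddCommGroup H] [InnerProductSpace ℂ H] [CompleteSpace H]
  [RKHS ℂ H (UnitBall d) (jointKernel T a)]

/-- `‖k_0 η‖² = ⟨κ(0,0) η, η⟩`, and `κ(0,0)` is the sum of all the projections. -/
lemma norm_starProjection_le_norm_kerFun_origin (ha : 0 < a)
    (hT : ∀ j, (T j).FiniteBranchingIndex) (hK : RKHS.kernel H = treeKernel T a)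
    {F : Finset (Fin d)} {u : ∀ i, V i} (hu : u ∈ Omega T F) (η : jointKernel T a) :
    ‖(solutionSpace T a u F).starProjection η‖ ≤ ‖RKHS.kerFun H (origin d) η‖ := by
  obtain ⟨s, hsmem, hs⟩ := exists_treeKernel_eq T ha hT
  by_cases hL : solutionSpace T a u F = ⊥
  · simp [hL]
  have h0 : treeKernel T a (origin d) (origin d) =
      ∑ p ∈ s, (solutionSpace T a p.2 p.1).starProjection := by
    rw [hs]
    refine Finset.sum_congr rfl fun p _ => ?_
    rw [scalarKernel_origin _ rfl, one_smul]
  rw [← sq_le_sq₀ (norm_nonneg _) (norm_nonneg _),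
    ← inner_self_eq_norm_sq (𝕜 := ℂ) (RKHS.kerFun H _ η),
    ← RKHS.kernel_inner, hK, h0]
  exact norm_starProjection_sq_le s (fun p => solutionSpace T a p.2 p.1)
    ((hsmem F u).2 ⟨hu, hL⟩) η

variable {H' : Type*} [NormedAddCommGroup H'] [InnerProductSpace ℂ H'] [CompleteSpace H']
  [RKHS ℂ H' (UnitBall d) ℂ]

lemma not_isBranching_of_hilbertModulesIsomorphic (ha : 0 < a)
    (hT : ∀ j, (T j).FiniteBranchingIndex) (hK : RKHS.kernel H = treeKernel T a)
    (hK' : RKHS.kernel H' = classicalKernel d a) {h : IsHilbertModule H}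
    {h' : IsHilbertModule H'} (hiso : HilbertModulesIsomorphic h h') (j : Fin d) (p : V j) :
    ¬ (T j).IsBranching p := by
  intro hp
  obtain ⟨u, hu, f, hf, hf0, hfroot⟩ := exists_mem_solutionSpace_singleton T (a := a) hp
  obtain ⟨U, hU⟩ := hiso
  set k : jointKernel T a → H := fun η => RKHS.kerFun H (origin d) η with hk
  have horth : ∀ η i (g : H'), ⟪coordMul h' i g, U (k η)⟫_ℂ = 0 := by
    intro η i g
    obtain ⟨g, rfl⟩ := U.surjective g
    rw [← hU, U.inner_map_map, hk, inner_coordMul_kerFun_origin]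
  -- `U (k η)` is a constant function, so its value at the origin determines it.
  have hzero : ∀ η, U (k η) (origin d) = 0 → k η = 0 := by
    intro η h0
    rw [← U.map_eq_zero_iff]
    refine RKHS.ext fun w => ?_
    rw [apply_eq_apply_origin hK' h' (horth η) w, h0]
    simp
  set c₁ : ℂ := U (k (rootElement T a)) (origin d) with hc₁
  set c₂ : ℂ := U (k f) (origin d) with hc₂
  -- The coefficients are chosen so that the values at the origin cancel. Projecting to
  -- `L_{root,∅}`, where `f` contributes nothing, then gives `c₂ = 0`; hence `k f = 0` and finally
  -- `f = 0`.
  have hcomb : k (c₂ • rootElement T a - c₁ • f) = 0 := by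
    refine hzero _ ?_
    simp only [hk, map_sub, map_smul, RKHS.coe_sub, RKHS.coe_smul, Pi.sub_apply, Pi.smul_apply,
      smul_eq_mul]
    rw [hc₁, hc₂, mul_comm]
    exact sub_self _
  have hc₂0 : c₂ = 0 := by
    have h1 := norm_starProjection_le_norm_kerFun_origin ha hT hK
      ((mem_omega_empty_iff T).2 rfl) (c₂ • rootElement T a - c₁ • f)
    have h2 : RKHS.kerFun H (origin d) (c₂ • rootElement T a - c₁ • f) = 0 := hcomb
    rw [h2, norm_zero, norm_le_zero_iff] at h1
    have h3 : ⟪rootElement T a, (solutionSpace T a (rootVec T) ∅).starProjection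
        (c₂ • rootElement T a - c₁ • f)⟫_ℂ = 0 := by rw [h1, inner_zero_right]
    rw [← Submodule.inner_starProjection_left_eq_right,
      Submodule.starProjection_eq_self_iff.2 (rootElement_mem_solutionSpace T),
      inner_rootElement] at h3
    have h4 : c₂ * (rootElement T a : L2 V) (rootVec T) - c₁ * (f : L2 V) (rootVec T) = 0 := h3
    simpa [hfroot, rootElement_apply_root] using h4
  have h1 := norm_starProjection_le_norm_kerFun_origin ha hT hK hu f
  have h2 : RKHS.kerFun H (origin d) f = 0 := hzero f hc₂0
  rw [h2, norm_zero, norm_le_zero_iff, Submodule.starProjection_eq_self_iff.2 hf] at h1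
  exact hf0 h1

lemma treeKernel_eq_of_not_isBranching (ha : 0 < a) (hT : ∀ j, (T j).FiniteBranchingIndex)
    (hb : ∀ j p, ¬ (T j).IsBranching p) (z w : UnitBall d) :
    treeKernel T a z w =
      scalarKernel a 0 z w • (solutionSpace T a (rootVec T) ∅).starProjection := by
  obtain ⟨s, hsmem, hs⟩ := exists_treeKernel_eq T ha hT
  rw [hs, Finset.sum_eq_single ⟨∅, rootVec T⟩]
  · rw [mdepth_rootVec]
  · rintro ⟨F, u⟩ hp hne
    obtain ⟨hu, hL⟩ := (hsmem F u).1 hp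
    rcases F.eq_empty_or_nonempty with rfl | ⟨j, hj⟩
    · rw [(mem_omega_empty_iff T).1 hu] at hne
      exact absurd rfl hne
    · exact absurd (isBranching_par_of_solutionSpace_ne_bot T ha hu.1 hL hj) (hb _ _)
  · intro hp
    rw [hsmem, not_and_not_right] at hp
    simp [hp ((mem_omega_empty_iff T).2 rfl)]

lemma hilbertModulesIsomorphic_of_not_isBranching (ha : 0 < a)
    (hT : ∀ j, (T j).FiniteBranchingIndex) (hK : RKHS.kernel H = treeKernel T a)
    (hK' : RKHS.kernel H' = classicalKernel d a) (h : IsHilbertModule H)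
    (h' : IsHilbertModule H') (hb : ∀ j p, ¬ (T j).IsBranching p) :
    HilbertModulesIsomorphic h h' := by
  -- Generally not injective: it forgets the part of the joint kernel orthogonal to `e`, which the
  -- tree kernel annihilates here.
  set ℓ : jointKernel T a →L[ℂ] ℂ := innerSL ℂ (rootElement T a) with hℓ
  have hnorm : ‖rootElement T a‖ = 1 := by
    rw [← sq_eq_sq₀ (norm_nonneg _) zero_le_one, ← inner_self_eq_norm_sq (𝕜 := ℂ),
      inner_rootElement, rootElement_apply_root]
    simp
  have hsurj : Function.Surjective ℓ := fun c =>
    ⟨c • rootElement T a, by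
      rw [map_smul, hℓ, innerSL_apply_apply, inner_rootElement, rootElement_apply_root,
        smul_eq_mul, mul_one]⟩
  have hP : ∀ v, (solutionSpace T a (rootVec T) ∅).starProjection v = ℓ v • rootElement T a := by
    intro v
    rw [hℓ, innerSL_apply_apply]
    simp only [solutionSpace_rootVec_eq_span]
    exact Submodule.starProjection_unit_singleton ℂ hnorm v
  obtain ⟨U, hU⟩ := RKHS.exists_linearIsometryEquiv H H' ℓ hsurj (by
    intro z w v v'
    rw [hK, hK', treeKernel_eq_of_not_isBranching ha hT hb, classicalKernel, Matrix.of_apply,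
      scalarKernel_zero ha]
    simp only [FunLike.coe_smul, Pi.smul_apply, ContinuousLinearMap.id_apply, hP,
      smul_eq_mul]
    simp [hℓ]
    ring)
  refine ⟨U, fun k f => RKHS.ext fun z => ext_inner_left ℂ fun c => ?_⟩
  obtain ⟨v, rfl⟩ := hsurj c
  rw [hU, coordMul_apply, coordMul_apply, inner_smul_right, inner_smul_right, hU]

end Tree

end TreeModule

end

theorem corollary1p6 {a d : ℕ} (ha : 0 < a) (hd : 0 < d) {V : Fin d → Type*}
    (T : ∀ j, TreeModule.RootedTree (V j)) (hT : ∀ j, (T j).FiniteBranchingIndex) :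
    ∃ (_ : Fact (TreeModule.treeKernel T a).PosSemidef)
      (_ : Fact (TreeModule.classicalKernel d a).PosSemidef)
      (h₁ : TreeModule.IsHilbertModule (TreeModule.TreeSpace T a))
      (h₂ : TreeModule.IsHilbertModule (TreeModule.ClassicalSpace d a)),
      TreeModule.HilbertModulesIsomorphic h₁ h₂ ↔
        ∀ j, TreeModule.GraphIsomorphic (T j) TreeModule.rayTree := by
  have i₁ : Fact (TreeModule.treeKernel T a).PosSemidef :=
    ⟨TreeModule.posSemidef_treeKernel ha hT⟩
  have i₂ : Fact (TreeModule.classicalKernel d a).PosSemidef :=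
    ⟨TreeModule.posSemidef_classicalKernel ha⟩
  have hK₁ : RKHS.kernel (TreeModule.TreeSpace T a) = TreeModule.treeKernel T a :=
    RKHS.OfKernel.kernel_ofKernel
  have hK₂ : RKHS.kernel (TreeModule.ClassicalSpace d a) = TreeModule.classicalKernel d a :=
    RKHS.OfKernel.kernel_ofKernel
  obtain ⟨s, -, hs⟩ := TreeModule.exists_treeKernel_eq T ha hT
  have h₁ : TreeModule.IsHilbertModule (TreeModule.TreeSpace T a) :=
    TreeModule.isHilbertModule_of_kernel_eq _ ha s (fun p => TreeModule.mdepth T p.2)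
      (fun p => TreeModule.solutionSpace T a p.2 p.1) fun z w => by rw [hK₁, hs]
  have h₂ : TreeModule.IsHilbertModule (TreeModule.ClassicalSpace d a) :=
    TreeModule.isHilbertModule_of_kernel_eq _ ha {()} (fun _ => 0) (fun _ => ⊤) fun z w => by
      rw [hK₂, TreeModule.classicalKernel_eq ha]
  refine ⟨i₁, i₂, h₁, h₂, ?_⟩
  simp only [TreeModule.RootedTree.graphIsomorphic_rayTree_iff]
  exact ⟨TreeModule.not_isBranching_of_hilbertModulesIsomorphic ha hT hK₁ hK₂,
    TreeModule.hilbertModulesIsomorphic_of_not_isBranching ha hT hK₁ hK₂ h₁ h₂⟩
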